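/- **Setting.** *Geometric Lorenz flow.* Let $f^t$ be a $C^\infty$ flow on a smooth 3-manifold $M$ (Hausdorff, second countable). Assume that there are reals $\alpha_{ss}<\alpha_s<0<-\alpha_s<\alpha_u$, a number $\rho>1$ and a smooth chart whose image contains the box $[-\rho,\rho]\times[-1,1]\times[-1,1]$, in which the flow is $(x,y,z)\mapsto(e^{\alpha_ut}x,e^{\alpha_{ss}t}y,e^{\alpha_st}z)$ as long as the orbit stays in the box. Let $S=\{z=1,\ |x|\le1,\ |y|\le1\}$ and $\Gamma=S\cap\{x=0\}$. For a point $q$ let $R(q)=\inf\{t>0: f^t(q)\in S\}$; on $S\setminus\Gamma$ this is the first return time to $S$, and $P(q)=f^{R(q)}(q)$ is the Poincaré transformation. The orbit of $(x,y,1)\in S\setminus\Gamma$ leaves the box at $(\pm\rho,\,y(|x|/\rho)^{-\alpha_{ss}/\alpha_u},\,(|x|/\rho)^{-\alpha_s/\alpha_u})$, $\pm=\operatorname{sign}x$. Let $E=\{(y,z):0\le z\le\rho^{\alpha_s/\alpha_u},\ |y|\le z^{\alpha_{ss}/\alpha_s}\}$ be the compact set of these exit coordinates $(y,z)$ together with the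 cusp $(0,0)$. Assume that every orbit starting at $(\pm\rho,y,z)$, $(y,z)\in E$, hits $S$ in positive time, that the first hitting time is continuous on $E$, and that the first hitting point is $(a_\pm(z),b_\pm(y,z),1)$, where $a_\pm$ and $b_\pm$ are $C^\infty$ near $[0,\rho^{\alpha_s/\alpha_u}]$ and near $E$ respectively, $a_\pm'\neq0$ on $[0,\rho^{\alpha_s/\alpha_u}]$ and $a_-=-a_+$ there. Consequently $P(x,y)=(g(x),h(x,y))$ on $S\setminus\Gamma$ with $g(x)=a_\pm((|x|/\rho)^{-\alpha_s/\alpha_u})$, and $g$ is odd. Assume that for some $\theta>0$ with $\theta^{-1}>\sqrt2$ one has $|g'(x)|\ge\theta^{-1}$ for $0<|x|<1$ and $|\partial_yh(x,y)|\le\theta$ for $0<|x|\le 1$, $|y|\le1$. *Induced return.* Let $0<\delta<1$, $\hat I=(-\delta,\delta)$, and let $\{\hat I(l):l\in\mathbb N\}$ be pairwise disjoint nonempty open subintervals of $\hat I$ that cover $\hat I$ up to a Lebesgue null set. Let $\hat r$ be equal to an integer $r_l\ge1$ on $\hat I(l)$, such that for $0\le j<r_l$ the set $g^j(\hat I(l))$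 does not contain $0$, and $\hat g=g^{\hat r}$ maps each $\hat I(l)$ diffeomorphically onto $\hat I$. Assume that $\hat r$ is Lebesgue integrable on $\hat I$ and that there are constants $C$ and $0<c<1$ such that $\log(|\hat g'(x)|/|\hat g'(y)|)\le C\,c^{n}$ whenever $n\ge1$ and, for every $0\le i<n$, the points $\hat g^i(x)$ and $\hat g^i(y)$ lie in one and the same element of the partition. *Symbolic section.* Let $N=\mathbb N^{\mathbb Z}$ with the shift map $f$. A sequence $(l_n)\in N$ is identified, by a map $\phi$, with the point $q_0\in S$ for which there is a sequence $(q_n)_{n\in\mathbb Z}$ in $S$ such that $q_n$ has its $x$-coordinate in $\hat I(l_n)$ and $P^{r_{l_n}}(q_n)=q_{n+1}$ for all $n\in\mathbb Z$ (there is at most one such point; sequences without such a point form a null set for the measures below). Let $\hat\mu$ be a probability measure on $\hat I$ that is absolutely continuous with respect to Lebesgue measure, $\hat g$-invariant and ergodic (for example the normalized restriction to $\hat I$ of the absolutely continuous invariant probability of $g$, whenever that restriction is invariant and ergodic for $\hat g$). Let $\mu$ be its lift to $N$: the $f$-invariant ergodic probability measure on $N$ whose image on $\mathbb N^{\{n\ge0\}}$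 under $(l_n)_{n\in\mathbb Z}\mapsto(l_n)_{n\ge0}$ is the image of $\hat\mu$ under the map that assigns to a point its $\hat g$-itinerary. **Proposition 3.2.** The return time to the symbolic section, $$T(w)=\sum_{j=0}^{r_{l_0}-1}R\bigl(P^j(\phi(w))\bigr),\qquad w=(l_n)_{n\in\mathbb Z}\in N,$$ is integrable with respect to $\mu$. -/

import Mathlib

open MeasureTheory Set Filter Topology
open scoped Manifold ContDiff

noncomputable section

/-- A smooth flow on a three-manifold with a linearised saddle singularity.
In the smooth chart the flow is `(x, y, z) ↦ (e^{αu t} x, e^{αss t} y, e^{αs t} z)` as long as the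
orbit stays in the box `[-ρ, ρ] × [-1, 1] × [-1, 1]`, with `αss < αs < 0 < -αs < αu`. -/
structure LorenzSaddle (M : Type*) [TopologicalSpace M]
    [ChartedSpace (EuclideanSpace ℝ (Fin 3)) M] [IsManifold (𝓡 3) ∞ M] where
  flow : Flow ℝ M
  smooth_flow : ContMDiff (𝓘(ℝ, ℝ).prod (𝓡 3)) (𝓡 3) ∞ (fun p : ℝ × M => flow p.1 p.2)
  chart : OpenPartialHomeomorph M (EuclideanSpace ℝ (Fin 3))
  chart_mem : chart ∈ IsManifold.maximalAtlas (𝓡 3) ∞ M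
  αss : ℝ
  αs : ℝ
  αu : ℝ
  αss_lt : αss < αs
  αs_neg : αs < 0
  αs_add_αu : 0 < αs + αu
  ρ : ℝ
  one_lt_ρ : 1 < ρ
  box_subset : ∀ x y z : ℝ, |x| ≤ ρ → |y| ≤ 1 → |z| ≤ 1 → !₂[x, y, z] ∈ chart.target
  linear : ∀ x y z t : ℝ, 0 ≤ t →
    (∀ s ∈ Icc 0 t, |Real.exp (αu * s) * x| ≤ ρ ∧ |Real.exp (αss * s) * y| ≤ 1 ∧
      |Real.exp (αs * s) * z| ≤ 1) →
    flow t (chart.symm !₂[x, y, z]) =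
      chart.symm !₂[Real.exp (αu * t) * x, Real.exp (αss * t) * y, Real.exp (αs * t) * z]

namespace LorenzSaddle

variable {M : Type*} [TopologicalSpace M]
    [ChartedSpace (EuclideanSpace ℝ (Fin 3)) M] [IsManifold (𝓡 3) ∞ M]

/-- The point of `M` with the given linearising coordinates. -/
def pt (D : LorenzSaddle M) (x y z : ℝ) : M := D.chart.symm !₂[x, y, z]

/-- The cross section is parametrised by `[-1, 1] × [-1, 1]`; it lies in `z = 1`. -/
def sec (D : LorenzSaddle M) (x y : ℝ) : M := D.pt x y 1

/-- The cross section `S`. The curve `Γ = S ∩ {x = 0}` lies in the stable manifold of the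
singularity; the leaves of the foliation of `S` are the curves `x = const`. -/
def S (D : LorenzSaddle M) : Set M := {q | ∃ x ∈ Icc (-1 : ℝ) 1, ∃ y ∈ Icc (-1 : ℝ) 1, q = D.sec x y}

/-- The first time `t > 0` at which the orbit of `q` hits `S`. On `S \ Γ` it is the first return
time to `S`. -/
def R (D : LorenzSaddle M) (q : M) : ℝ := sInf {t : ℝ | 0 < t ∧ D.flow t q ∈ D.S}

/-- The Poincaré transformation `P(q) = f^{R(q)}(q)`, of interest on `S \ Γ`. -/
def P (D : LorenzSaddle M) (q : M) : M := D.flow (D.R q) q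

/-- The `z`-coordinate `(|x|/ρ)^{-αs/αu}` at which the orbit of `sec x y` (with `0 < |x| ≤ 1`)
leaves the box through the face `x = ±ρ`. -/
def exitZ (D : LorenzSaddle M) (x : ℝ) : ℝ := (|x| / D.ρ) ^ (-D.αs / D.αu)

/-- The `y`-coordinate `y (|x|/ρ)^{-αss/αu}` at which the orbit of `sec x y` leaves the box. -/
def exitY (D : LorenzSaddle M) (x y : ℝ) : ℝ := y * (|x| / D.ρ) ^ (-D.αss / D.αu)

/-- The (cusp shaped, compact) set of the coordinates `(y, z)` of the exit points of `S \ Γ` on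
either of the faces `x = ±ρ`, together with the cusp `(0, 0)`, which is on the unstable manifold
of the singularity. -/
def exitRegion (D : LorenzSaddle M) : Set (ℝ × ℝ) :=
  {p | p.2 ∈ Icc 0 (D.exitZ 1) ∧ |p.1| ≤ p.2 ^ (D.αss / D.αs)}

/-- The map `x ↦ a_±(exitZ x)`, `± = sign x`. -/
def leafMap (D : LorenzSaddle M) (a : ℝ → ℝ → ℝ) (x : ℝ) : ℝ := a (Real.sign x) (D.exitZ x)

/-- The map `(x, y) ↦ b_±(exitY x y, exitZ x)`, `± = sign x`. -/
def fiberMap (D : LorenzSaddle M) (b : ℝ → ℝ × ℝ → ℝ) (x y : ℝ) : ℝ :=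
  b (Real.sign x) (D.exitY x y, D.exitZ x)

theorem exitZ_mem (D : LorenzSaddle M) {x : ℝ} (h0 : 0 < |x|) (h1 : |x| ≤ 1) :
    0 < D.exitZ x ∧ D.exitZ x ≤ D.exitZ 1 ∧ D.exitZ x < 1 := by
  have hρ := D.one_lt_ρ
  have hu : 0 < D.αu := by linarith [D.αs_neg, D.αs_add_αu]
  have he : 0 < -D.αs / D.αu := div_pos (by linarith [D.αs_neg]) hu
  have hq : 0 < |x| / D.ρ := by positivity
  refine ⟨Real.rpow_pos_of_pos hq _, ?_, Real.rpow_lt_one hq.le ?_ he⟩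
  · unfold exitZ
    refine Real.rpow_le_rpow hq.le ?_ he.le
    rw [abs_one]
    gcongr
  · rw [div_lt_one (by linarith)]; linarith

theorem exit_mem (D : LorenzSaddle M) {x y : ℝ} (h0 : 0 < |x|) (h1 : |x| ≤ 1) (hy : |y| ≤ 1) :
    (D.exitY x y, D.exitZ x) ∈ D.exitRegion := by
  have hρ := D.one_lt_ρ
  have hu : 0 < D.αu := by linarith [D.αs_neg, D.αs_add_αu]
  have hq : 0 < |x| / D.ρ := by positivity
  obtain ⟨hz0, hz1, -⟩ := D.exitZ_mem h0 h1
  refine ⟨⟨hz0.le, hz1⟩, ?_⟩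
  have e : D.exitZ x ^ (D.αss / D.αs) = (|x| / D.ρ) ^ (-D.αss / D.αu) := by
    unfold exitZ
    rw [← Real.rpow_mul hq.le]
    congr 1
    have := D.αs_neg.ne
    field_simp
  have hp := Real.rpow_pos_of_pos hq (-D.αss / D.αu)
  simp only [e, exitY, abs_mul, abs_of_pos hp]
  nlinarith

theorem pt_mem_S_iff (D : LorenzSaddle M) {x y z : ℝ} (hx : |x| ≤ D.ρ) (hy : |y| ≤ 1)
    (hz : |z| ≤ 1) : D.pt x y z ∈ D.S ↔ |x| ≤ 1 ∧ z = 1 := by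
  have hρ := D.one_lt_ρ
  constructor
  · rintro ⟨x', hx', y', hy', e⟩
    have hx'' := abs_le.2 hx'
    have hy'' := abs_le.2 hy'
    have e' := D.chart.symm.injOn (by simpa using D.box_subset x y z hx hy hz)
      (by simpa using D.box_subset x' y' 1 (by linarith) hy'' (by simp)) e
    have ex : x = x' := by simpa using congrArg (fun w : EuclideanSpace ℝ (Fin 3) => w 0) e'
    have ez : z = 1 := by simpa using congrArg (fun w : EuclideanSpace ℝ (Fin 3) => w 2) e'
    exact ⟨ex ▸ hx'', ez⟩
  · rintro ⟨hx1, rfl⟩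
    exact ⟨x, abs_le.1 hx1, y, abs_le.1 hy, rfl⟩

/-- The passage of the orbit of `sec x y` through the box. -/
theorem flow_sec (D : LorenzSaddle M) {x y t : ℝ} (h0 : 0 < |x|) (hy : |y| ≤ 1)
    (ht : 0 ≤ t) (ht' : t ≤ Real.log (D.ρ / |x|) / D.αu) :
    D.flow t (D.sec x y) =
      D.pt (Real.exp (D.αu * t) * x) (Real.exp (D.αss * t) * y) (Real.exp (D.αs * t)) ∧
    |Real.exp (D.αu * t) * x| ≤ D.ρ ∧ |Real.exp (D.αss * t) * y| ≤ 1 ∧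
      |Real.exp (D.αs * t)| ≤ 1 := by
  have hρ := D.one_lt_ρ
  have hu : 0 < D.αu := by linarith [D.αs_neg, D.αs_add_αu]
  have key : ∀ s, 0 ≤ s → s ≤ t → |Real.exp (D.αu * s) * x| ≤ D.ρ ∧
      |Real.exp (D.αss * s) * y| ≤ 1 ∧ |Real.exp (D.αs * s)| ≤ 1 := by
    intro s hs hst
    simp only [abs_mul, Real.abs_exp]
    refine ⟨?_, ?_, ?_⟩
    · have : D.αu * s ≤ Real.log (D.ρ / |x|) := by
        rw [le_div_iff₀ hu] at ht'; nlinarith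
      rw [Real.le_log_iff_exp_le (by positivity), le_div_iff₀ h0] at this
      exact this
    · have : Real.exp (D.αss * s) ≤ 1 :=
        Real.exp_le_one_iff.2 (by nlinarith [D.αss_lt, D.αs_neg])
      nlinarith [abs_nonneg y, Real.exp_pos (D.αss * s)]
    · exact Real.exp_le_one_iff.2 (by nlinarith [D.αs_neg])
  refine ⟨?_, key t ht le_rfl⟩
  have := D.linear x y 1 t ht (fun s hs => by simpa using key s hs.1 hs.2)
  simpa [sec, pt] using this

theorem flow_exit (D : LorenzSaddle M) {x y : ℝ} (h0 : 0 < |x|) (h1 : |x| ≤ 1) (hy : |y| ≤ 1) :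
    D.flow (Real.log (D.ρ / |x|) / D.αu) (D.sec x y) =
      D.pt (Real.sign x * D.ρ) (D.exitY x y) (D.exitZ x) := by
  have hρ := D.one_lt_ρ
  have hu : 0 < D.αu := by linarith [D.αs_neg, D.αs_add_αu]
  have hq : 0 < |x| / D.ρ := by positivity
  have hl : 0 ≤ Real.log (D.ρ / |x|) / D.αu := by
    refine div_nonneg (Real.log_nonneg ?_) hu.le
    rw [le_div_iff₀ h0]; linarith
  rw [(D.flow_sec h0 hy hl le_rfl).1]
  have hlog : Real.log (D.ρ / |x|) = -Real.log (|x| / D.ρ) := by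
    rw [← Real.log_inv, inv_div]
  have hx : Real.sign x * |x| = x := by
    rcases lt_trichotomy x 0 with h | h | h
    · rw [Real.sign_of_neg h, abs_of_neg h]; ring
    · simp [h]
    · rw [Real.sign_of_pos h, abs_of_pos h]; ring
  congr 1
  · rw [mul_div_cancel₀ _ hu.ne', Real.exp_log (by positivity)]
    rw [div_mul_eq_mul_div, div_eq_iff h0.ne', mul_right_comm, hx, mul_comm]
  · rw [exitY, Real.rpow_def_of_pos hq, mul_comm, hlog]
    congr 2; ring
  · rw [exitZ, Real.rpow_def_of_pos hq, hlog]
    congr 1; ring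

end LorenzSaddle

/-- A geometric Lorenz flow. The orbits that leave the box through the faces `x = sρ`, `s = ±1`,
come back to the cross section `S`; the first hitting time is continuous up to the cusp, and the
first hitting point is `sec (a s z) (b s (y, z))` with `a`, `b` smooth up to the cusp and
`∂a/∂z ≠ 0`, so that the foliation `x = const` of `S` is invariant. The Poincaré transformation is
then `(x, y) ↦ (g x, h x y)`, see `GeometricLorenzFlow.P_sec`. -/
structure GeometricLorenzFlow (M : Type*) [TopologicalSpace M]
    [ChartedSpace (EuclideanSpace ℝ (Fin 3)) M] [IsManifold (𝓡 3) ∞ M] extends LorenzSaddle M where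
  a : ℝ → ℝ → ℝ
  b : ℝ → ℝ × ℝ → ℝ
  continuousOn_hit : ∀ s : ℝ, s = 1 ∨ s = -1 → ContinuousOn
    (fun p : ℝ × ℝ => toLorenzSaddle.R (toLorenzSaddle.pt (s * ρ) p.1 p.2))
    toLorenzSaddle.exitRegion
  landing : ∀ s : ℝ, s = 1 ∨ s = -1 → ∀ p ∈ toLorenzSaddle.exitRegion,
    a s p.2 ∈ Icc (-1 : ℝ) 1 ∧ b s p ∈ Icc (-1 : ℝ) 1 ∧
    toLorenzSaddle.P (toLorenzSaddle.pt (s * ρ) p.1 p.2) = toLorenzSaddle.sec (a s p.2) (b s p)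
  a_smooth : ∀ s : ℝ, s = 1 ∨ s = -1 → ∀ z ∈ Icc 0 (toLorenzSaddle.exitZ 1),
    ContDiffAt ℝ ∞ (a s) z ∧ deriv (a s) z ≠ 0
  b_smooth : ∀ s : ℝ, s = 1 ∨ s = -1 → ∀ p ∈ toLorenzSaddle.exitRegion,
    ContDiffAt ℝ ∞ (b s) p
  /-- The symmetry `g (-x) = - g x`. -/
  a_odd : ∀ z ∈ Icc 0 (toLorenzSaddle.exitZ 1), a (-1) z = - a 1 z
  θ : ℝ
  θ_pos : 0 < θ
  sqrt_two_lt : Real.sqrt 2 < θ⁻¹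
  expanding : ∀ x : ℝ, 0 < |x| → |x| < 1 → θ⁻¹ ≤ |deriv (toLorenzSaddle.leafMap a) x|
  contracting : ∀ x y : ℝ, 0 < |x| → |x| ≤ 1 → |y| ≤ 1 →
    |deriv (toLorenzSaddle.fiberMap b x) y| ≤ θ

namespace GeometricLorenzFlow

variable {M : Type*} [TopologicalSpace M]
    [ChartedSpace (EuclideanSpace ℝ (Fin 3)) M] [IsManifold (𝓡 3) ∞ M]

/-- The one-dimensional Lorenz map `g`, of interest on `[-1, 1] \ {0}`. -/
def g (F : GeometricLorenzFlow M) : ℝ → ℝ := F.leafMap F.a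

/-- The second coordinate `h` of the Poincaré transformation. -/
def h (F : GeometricLorenzFlow M) : ℝ → ℝ → ℝ := F.fiberMap F.b

/-- On `S \ Γ` the first return time is the passage time `log (ρ / |x|) / αu` through the box plus
the time from the exit point back to `S`, and the Poincaré transformation is `(g x, h x y)`. -/
theorem P_sec (F : GeometricLorenzFlow M) {x y : ℝ} (h0 : 0 < |x|) (h1 : |x| ≤ 1) (hy : |y| ≤ 1) :
    F.R (F.sec x y) = Real.log (F.ρ / |x|) / F.αu +
      F.R (F.pt (Real.sign x * F.ρ) (F.exitY x y) (F.exitZ x)) ∧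
    F.P (F.sec x y) = F.sec (F.g x) (F.h x y) ∧
    F.g x ∈ Icc (-1 : ℝ) 1 ∧ F.h x y ∈ Icc (-1 : ℝ) 1 := by
  have hρ := F.one_lt_ρ
  have hu : 0 < F.αu := by linarith [F.αs_neg, F.αs_add_αu]
  set t₀ := Real.log (F.ρ / |x|) / F.αu with ht₀
  have ht₀_pos : 0 < t₀ := by
    refine div_pos (Real.log_pos ?_) hu
    rw [lt_div_iff₀ h0]; linarith
  set e := F.pt (Real.sign x * F.ρ) (F.exitY x y) (F.exitZ x) with he
  have hs : Real.sign x = 1 ∨ Real.sign x = -1 := by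
    rcases lt_or_gt_of_ne (abs_pos.1 h0) with h | h
    · exact Or.inr (Real.sign_of_neg h)
    · exact Or.inl (Real.sign_of_pos h)
  have hexit : F.flow t₀ (F.sec x y) = e := F.flow_exit h0 h1 hy
  obtain ⟨ha, hb, hl⟩ := F.landing _ hs _ (F.exit_mem h0 h1 hy)
  have hlS : F.P e ∈ F.S := by rw [hl]; exact ⟨_, ha, _, hb, rfl⟩
  have hno : ∀ t, 0 < t → t ≤ t₀ → F.flow t (F.sec x y) ∉ F.S := by
    intro t ht ht' hS
    obtain ⟨h₁, h₂, h₃, h₄⟩ := F.flow_sec h0 hy ht.le ht'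
    rw [h₁, F.pt_mem_S_iff h₂ h₃ h₄] at hS
    have : Real.exp (F.αs * t) < 1 := Real.exp_lt_one_iff.2 (by nlinarith [F.αs_neg])
    linarith [hS.2]
  have heS : e ∉ F.S := by
    rw [← hexit]; exact hno t₀ ht₀_pos le_rfl
  have hadd : ∀ s, F.flow (t₀ + s) (F.sec x y) = F.flow s e := by
    intro s; rw [← hexit, add_comm, F.flow.map_add]
  have hne : {t : ℝ | 0 < t ∧ F.flow t e ∈ F.S}.Nonempty := by
    by_contra hcon
    rw [Set.not_nonempty_iff_eq_empty] at hcon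
    apply heS
    have h00 : F.R e = 0 := by rw [LorenzSaddle.R, hcon, Real.sInf_empty]
    have : F.P e = e := by rw [LorenzSaddle.P, h00, F.flow.map_zero_apply]
    rwa [← this]
  have hset : {t : ℝ | 0 < t ∧ F.flow t (F.sec x y) ∈ F.S} =
      (OrderIso.addLeft t₀) '' {t : ℝ | 0 < t ∧ F.flow t e ∈ F.S} := by
    ext t
    constructor
    · rintro ⟨ht, hS⟩
      have htt : t₀ < t := by
        by_contra hcon
        exact hno t ht (not_lt.1 hcon) hS
      refine ⟨t - t₀, ⟨by linarith, ?_⟩, by simp⟩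
      rw [← hadd]
      simpa using hS
    · rintro ⟨s, ⟨hs0, hS⟩, rfl⟩
      refine ⟨by simp; linarith, ?_⟩
      simpa [hadd] using hS
  have hR : F.R (F.sec x y) = t₀ + F.R e := by
    rw [LorenzSaddle.R, hset, LorenzSaddle.R, ← OrderIso.map_csInf' _ hne ⟨0, fun t ht => ht.1.le⟩]
    rfl
  refine ⟨hR, ?_, ha, hb⟩
  rw [LorenzSaddle.P, hR, hadd]
  exact hl

end GeometricLorenzFlow

/-- A full-branch return scheme of a map `g` on `(-δ, δ)`: open subintervals `(u l, v l)`, `l ∈ ℕ`,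
which partition `(-δ, δ)` up to a Lebesgue null set, and return times `r l ≥ 1` such that
`g^{r l}` maps `(u l, v l)` bijectively onto `(-δ, δ)`, without meeting the discontinuity `0` on
the way. (For a Lorenz map the branches are then automatically diffeomorphisms.) -/
structure ReturnScheme (g : ℝ → ℝ) where
  δ : ℝ
  δ_pos : 0 < δ
  δ_lt_one : δ < 1
  u : ℕ → ℝ
  v : ℕ → ℝ
  u_lt_v : ∀ l, u l < v l
  subset : ∀ l, Ioo (u l) (v l) ⊆ Ioo (-δ) δ
  disjoint : Pairwise fun l k => Disjoint (Ioo (u l) (v l)) (Ioo (u k) (v k))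
  cover : volume (Ioo (-δ) δ \ ⋃ l, Ioo (u l) (v l)) = 0
  r : ℕ → ℕ
  r_pos : ∀ l, 0 < r l
  avoid : ∀ l, ∀ x ∈ Ioo (u l) (v l), ∀ j < r l, g^[j] x ≠ 0
  full : ∀ l, BijOn (g^[r l]) (Ioo (u l) (v l)) (Ioo (-δ) δ)

namespace ReturnScheme

variable {g : ℝ → ℝ}

/-- The interval `(-δ, δ)`. -/
def base (G : ReturnScheme g) : Set ℝ := Ioo (-G.δ) G.δ

/-- The element number `l` of the partition of the base. -/
def piece (G : ReturnScheme g) (l : ℕ) : Set ℝ := Ioo (G.u l) (G.v l)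

open Classical in
/-- The number of the element of the partition in which `x` lies (`0` if there is none, which
in the base happens only on a Lebesgue null set). -/
def index (G : ReturnScheme g) (x : ℝ) : ℕ :=
  if hx : ∃ l, x ∈ G.piece l then hx.choose else 0

/-- The return time, constant on each element of the partition. -/
def rhat (G : ReturnScheme g) (x : ℝ) : ℕ := G.r (G.index x)

open Classical in
/-- The return map `x ↦ g^{rhat x}(x)`, with the value `0` off the elements of the partition. -/
def ghat (G : ReturnScheme g) (x : ℝ) : ℝ :=
  if ∃ l, x ∈ G.piece l then g^[G.rhat x] x else 0

/-- The itinerary of `x` under the return map: the inverse of the conjugacy between the one-sided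
full shift and the return map. -/
def itinerary (G : ReturnScheme g) (x : ℝ) : ℕ → ℕ := fun n => G.index (G.ghat^[n] x)

end ReturnScheme

/-- A return scheme with Lebesgue integrable return time and with bounded distortion: if the first
`n ≥ 1` iterates `x, …, ghat^{n-1} x` lie in the same elements of the partition as those of `y`,
then `log (|ghat' x| / |ghat' y|) ≤ C c^n`. -/
structure MarkovInduction (g : ℝ → ℝ) extends ReturnScheme g where
  integrable_rhat : IntegrableOn (fun x => (toReturnScheme.rhat x : ℝ)) toReturnScheme.base volume
  c : ℝ
  c_pos : 0 < c
  c_lt_one : c < 1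
  C : ℝ
  distortion : ∀ (n : ℕ) (x y : ℝ), 1 ≤ n →
    (∀ i < n, ∃ l, toReturnScheme.ghat^[i] x ∈ toReturnScheme.piece l ∧
      toReturnScheme.ghat^[i] y ∈ toReturnScheme.piece l) →
    Real.log (|deriv toReturnScheme.ghat x| / |deriv toReturnScheme.ghat y|) ≤ C * c ^ n

/-- The shift map on the full shift space `ℕ^ℤ`. -/
def fullShift (w : ℤ → ℕ) : ℤ → ℕ := fun n => w (n + 1)

/-- The projection of the two-sided sequences onto the one-sided sequences. -/
def toOneSided (w : ℤ → ℕ) : ℕ → ℕ := fun n => w n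

namespace GeometricLorenzFlow

variable {M : Type*} [TopologicalSpace M]
    [ChartedSpace (EuclideanSpace ℝ (Fin 3)) M] [IsManifold (𝓡 3) ∞ M]

/-- The element `π⁻¹(piece l)` of the Markov partition of `π⁻¹(base) ⊆ S`, where `π` is the
projection along the leaves `x = const`. -/
def strip (F : GeometricLorenzFlow M) (G : MarkovInduction F.g) (l : ℕ) : Set M :=
  {q | ∃ x ∈ G.piece l, ∃ y ∈ Icc (-1 : ℝ) 1, q = F.sec x y}

/-- `q` is a two-sided orbit, with itinerary `w`, of the return map that equals `P^{r l}` on the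
strip number `l`. -/
def IsCoded (F : GeometricLorenzFlow M) (G : MarkovInduction F.g) (w : ℤ → ℕ) (q : ℤ → M) : Prop :=
  ∀ n : ℤ, q n ∈ F.strip G (w n) ∧ F.P^[G.r (w n)] (q n) = q (n + 1)

open Classical in
/-- The coding map from the full shift space to `S`: the point whose two-sided orbit under the
two-dimensional return map has the itinerary `w`. (By expansion along the leaf space and contraction
along the leaves there is at most one. There is none for exceptional sequences only, e.g. such
that the nested intersection of the open intervals is empty; there the value is irrelevant.) -/
def coding (F : GeometricLorenzFlow M) (G : MarkovInduction F.g) (w : ℤ → ℕ) : M :=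
  if hw : ∃ q, F.IsCoded G w q then hw.choose 0 else F.pt 0 0 0

/-- The return time `T = ∑_{j < r} R ∘ P^j` on the full shift space, which is identified with a
subset of `S` by the coding map. -/
def T (F : GeometricLorenzFlow M) (G : MarkovInduction F.g) (w : ℤ → ℕ) : ℝ :=
  ∑ j ∈ Finset.range (G.r (w 0)), F.R (F.P^[j] (F.coding G w))

end GeometricLorenzFlow

/-- `μhat` is an absolutely continuous ergodic invariant probability of the return map. -/
structure IsACErgodic {g : ℝ → ℝ} (G : MarkovInduction g) (μhat : Measure ℝ) : Prop where
  prob : IsProbabilityMeasure μhat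
  base : μhat G.baseᶜ = 0
  ac : μhat ≪ volume
  ergodic : Ergodic G.ghat μhat

/-- `μ` is the lift of `μhat` to the full shift space: it is invariant and ergodic, and it projects
to the image of `μhat` on the one-sided full shift space. -/
structure IsLift {g : ℝ → ℝ} (G : MarkovInduction g) (μhat : Measure ℝ) (μ : Measure (ℤ → ℕ)) :
    Prop where
  prob : IsProbabilityMeasure μ
  ergodic : Ergodic fullShift μ
  proj : μ.map toOneSided = μhat.map G.itinerary

end

noncomputable section

/-! The return time `R` and `log |g'|` blow up at the same rate at `x = 0`. The passage through the
box takes time `log (ρ / |x|) / αu`, and the rest of the excursion is bounded by compactness of the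
exit region. On the other side, `|g'|` is of order `|x| ^ (κ - 1)` with `κ = -αs / αu < 1`. Hence `R
≤ A + B log |g'|` (`exists_R_le_log_deriv`). Summing over the `r_l` steps of a return, the chain
rule turns the sum of the `log |g'|` into `log |ghat'|`. A branch maps an interval of length `p_l`
onto the whole base with bounded distortion, so `log |ghat'|` is at most a constant plus `|log p_l|`
(`log_abs_deriv_ghat_le`). Thus `T` is dominated by a function of the zeroth symbol, `A r_l + B |log
p_l|` with new constants (`exists_T_le`).

The density of `μhat` is bounded (`measure_le`): under a high iterate of `ghat`, each short cylinder
is spread over the base almost uniformly, up to the distortion constant. So the symbol `l` has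
`μ`-probability at most a constant times `p_l`, and two series must converge. The series of `r_l
p_l` is the integral of `rhat`. For `p_l |log p_l|`, the signs of `x` along the excursion determine
the branch, so at most `2 ^ n` branches have return time `n` and `∑ exp (-2 r_l)` converges;
moreover `p |log p| ≤ 4 r p + exp (-2 r)`.

The coding map is defined by choice, so measurability of `T` needs an argument: expansion forwards
and contraction backwards make the coded orbit unique, its graph is Borel, and injective measurable
images of Borel sets are Borel (`measurable_T`). -/

/-! ### Expanding interval maps. -/

theorem hasDerivAt_iterate_prod {f : ℝ → ℝ} {x : ℝ} (n : ℕ)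
    (h : ∀ j < n, DifferentiableAt ℝ f (f^[j] x)) :
    HasDerivAt f^[n] (∏ j ∈ Finset.range n, deriv f (f^[j] x)) x := by
  induction n with
  | zero => simpa using hasDerivAt_id x
  | succ n ih =>
    rw [Function.iterate_succ', Finset.prod_range_succ, mul_comm]
    exact (h n (Nat.lt_succ_self n)).hasDerivAt.comp x (ih fun j hj => h j (hj.trans n.lt_succ_self))

/-- Mean value inequality for a lower bound of the derivative. -/
theorem mul_abs_sub_le_of_le_abs_deriv {f : ℝ → ℝ} {s : Set ℝ} {k : ℝ} (hs : s.OrdConnected)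
    (hd : ∀ x ∈ s, DifferentiableAt ℝ f x) (hk : ∀ x ∈ s, k ≤ |deriv f x|) {x y : ℝ}
    (hx : x ∈ s) (hy : y ∈ s) : k * |x - y| ≤ |f x - f y| := by
  wlog hxy : x < y generalizing x y
  · rcases (not_lt.1 hxy).eq_or_lt with h | h
    · simp [h]
    · rw [abs_sub_comm, abs_sub_comm (f x)]
      exact this hy hx h
  have hsub : Icc x y ⊆ s := hs.out hx hy
  obtain ⟨z, hz, e⟩ := exists_deriv_eq_slope f hxy
    (fun t ht => (hd t (hsub ht)).continuousAt.continuousWithinAt)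
    (fun t ht => (hd t (hsub (Ioo_subset_Icc_self ht))).differentiableWithinAt)
  have hk' := hk z (hsub (Ioo_subset_Icc_self hz))
  rw [eq_div_iff (by linarith)] at e
  rw [abs_sub_comm, abs_sub_comm (f x), ← e, abs_mul]
  exact mul_le_mul_of_nonneg_right hk' (abs_nonneg _)

/-- A map of `(-1, 1)` that may be discontinuous at `0` and is uniformly expanding elsewhere. -/
structure IsExpandingOffZero (g : ℝ → ℝ) (lam : ℝ) : Prop where
  one_lt : 1 < lam
  abs_lt_one : ∀ x, 0 < |x| → |x| < 1 → |g x| < 1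
  le_abs_deriv : ∀ x, 0 < |x| → |x| < 1 → lam ≤ |deriv g x|

namespace IsExpandingOffZero

variable {g : ℝ → ℝ} {lam : ℝ}

theorem differentiableAt (hg : IsExpandingOffZero g lam) {x : ℝ} (h0 : 0 < |x|) (h1 : |x| < 1) :
    DifferentiableAt ℝ g x := by
  refine differentiableAt_of_deriv_ne_zero fun h => ?_
  have := hg.le_abs_deriv x h0 h1
  rw [h, abs_zero] at this
  linarith [hg.one_lt]

theorem eq_of_pos_iff (hg : IsExpandingOffZero g lam) {x y : ℝ} (hx0 : x ≠ 0) (hx1 : |x| < 1)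
    (hy0 : y ≠ 0) (hy1 : |y| < 1) (hs : 0 < x ↔ 0 < y) (e : g x = g y) : x = y := by
  have key : ∀ s : Set ℝ, s.OrdConnected → (∀ t ∈ s, t ≠ 0 ∧ |t| < 1) → x ∈ s → y ∈ s → x = y := by
    intro s hs ht hx hy
    have := mul_abs_sub_le_of_le_abs_deriv hs
      (fun t h => hg.differentiableAt (abs_pos.2 (ht t h).1) (ht t h).2)
      (fun t h => hg.le_abs_deriv t (abs_pos.2 (ht t h).1) (ht t h).2) hx hy
    rw [e, sub_self, abs_zero] at this
    have h0 : |x - y| = 0 :=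
      le_antisymm (by nlinarith [hg.one_lt, abs_nonneg (x - y)]) (abs_nonneg _)
    linarith [abs_eq_zero.1 h0]
  rw [abs_lt] at hx1 hy1
  rcases hx0.lt_or_gt with h | h
  · have hy : y < 0 := lt_of_le_of_ne (not_lt.1 fun h' => h.not_gt (hs.2 h')) hy0
    refine key (Ioo (-1) 0) ordConnected_Ioo (fun t ht => ⟨ht.2.ne, ?_⟩) ⟨hx1.1, h⟩ ⟨hy1.1, hy⟩
    rw [abs_lt]; constructor <;> linarith [ht.1, ht.2]
  · refine key (Ioo 0 1) ordConnected_Ioo (fun t ht => ⟨ht.1.ne', ?_⟩) ⟨h, hx1.2⟩ ⟨hs.1 h, hy1.2⟩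
    rw [abs_lt]; constructor <;> linarith [ht.1, ht.2]

/-- Each of the two branches of `g` is injective, so the sign word of an orbit and its end point
determine the starting point. This underlies the count of the branches of the return map. -/
theorem eq_of_iterate_eq (hg : IsExpandingOffZero g lam) (n : ℕ) {x y : ℝ}
    (hx : ∀ j < n, g^[j] x ≠ 0 ∧ |g^[j] x| < 1) (hy : ∀ j < n, g^[j] y ≠ 0 ∧ |g^[j] y| < 1)
    (hs : ∀ j < n, 0 < g^[j] x ↔ 0 < g^[j] y) (e : g^[n] x = g^[n] y) : x = y := by
  induction n with
  | zero => simpa using e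
  | succ n ih =>
    have hn := n.lt_succ_self
    refine ih (fun j hj => hx j (hj.trans hn)) (fun j hj => hy j (hj.trans hn))
      (fun j hj => hs j (hj.trans hn)) ?_
    rw [Function.iterate_succ_apply', Function.iterate_succ_apply'] at e
    exact hg.eq_of_pos_iff (hx n hn).1 (hx n hn).2 (hy n hn).1 (hy n hn).2 (hs n hn) e

end IsExpandingOffZero

/-! ### Branches of the return map: expansion and counting. -/

namespace ReturnScheme

variable {g : ℝ → ℝ} {lam : ℝ}

theorem index_eq (G : ReturnScheme g) {x : ℝ} {l : ℕ} (hx : x ∈ G.piece l) : G.index x = l := by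
  have hex : ∃ l, x ∈ G.piece l := ⟨l, hx⟩
  rw [index, dif_pos hex]
  by_contra hne
  exact Set.disjoint_left.1 (G.disjoint hne) hex.choose_spec hx

theorem rhat_eq (G : ReturnScheme g) {x : ℝ} {l : ℕ} (hx : x ∈ G.piece l) : G.rhat x = G.r l := by
  rw [rhat, G.index_eq hx]

theorem ghat_eq (G : ReturnScheme g) {x : ℝ} {l : ℕ} (hx : x ∈ G.piece l) :
    G.ghat x = g^[G.r l] x := by
  rw [ghat, if_pos ⟨l, hx⟩, G.rhat_eq hx]

theorem isOpen_piece (G : ReturnScheme g) (l : ℕ) : IsOpen (G.piece l) := isOpen_Ioo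

theorem measurableSet_piece (G : ReturnScheme g) (l : ℕ) : MeasurableSet (G.piece l) :=
  measurableSet_Ioo

theorem measurableSet_base (G : ReturnScheme g) : MeasurableSet G.base := measurableSet_Ioo

theorem piece_subset_base (G : ReturnScheme g) (l : ℕ) : G.piece l ⊆ G.base := G.subset l

theorem bijOn_ghat (G : ReturnScheme g) (l : ℕ) : BijOn G.ghat (G.piece l) G.base :=
  (G.full l).congr fun _ hx => (G.ghat_eq hx).symm

theorem abs_iterate_lt_one (G : ReturnScheme g) (hg : IsExpandingOffZero g lam) {x : ℝ} {l : ℕ}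
    (hx : x ∈ G.piece l) {j : ℕ} (hj : j ≤ G.r l) : |g^[j] x| < 1 := by
  induction j with
  | zero =>
    have := G.piece_subset_base l hx
    have h1 := G.δ_lt_one
    rw [Function.iterate_zero_apply, abs_lt]
    constructor <;> linarith [this.1, this.2]
  | succ j ih =>
    rw [Function.iterate_succ_apply']
    exact hg.abs_lt_one _ (abs_pos.2 (G.avoid l x hx j hj)) (ih (Nat.le_of_succ_le hj))

theorem hasDerivAt_branch (G : ReturnScheme g) (hg : IsExpandingOffZero g lam) {x : ℝ} {l : ℕ}
    (hx : x ∈ G.piece l) :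
    HasDerivAt G.ghat (∏ j ∈ Finset.range (G.r l), deriv g (g^[j] x)) x := by
  refine (hasDerivAt_iterate_prod (G.r l) fun j hj => hg.differentiableAt
    (abs_pos.2 (G.avoid l x hx j hj)) (G.abs_iterate_lt_one hg hx hj.le)).congr_of_eventuallyEq ?_
  filter_upwards [(G.isOpen_piece l).mem_nhds hx] with y hy using G.ghat_eq hy

theorem le_abs_deriv_ghat (G : ReturnScheme g) (hg : IsExpandingOffZero g lam) {x : ℝ} {l : ℕ}
    (hx : x ∈ G.piece l) : lam ≤ |deriv G.ghat x| := by
  have h1 := hg.one_lt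
  rw [(G.hasDerivAt_branch hg hx).deriv, Finset.abs_prod]
  calc lam ≤ lam ^ G.r l := le_self_pow₀ h1.le (G.r_pos l).ne'
    _ = ∏ j ∈ Finset.range (G.r l), lam := by simp
    _ ≤ _ := Finset.prod_le_prod (fun _ _ => by linarith) fun j hj => by
      rw [Finset.mem_range] at hj
      exact hg.le_abs_deriv _ (abs_pos.2 (G.avoid l x hx j hj)) (G.abs_iterate_lt_one hg hx hj.le)

theorem mul_abs_sub_le (G : ReturnScheme g) (hg : IsExpandingOffZero g lam) {x y : ℝ} {l : ℕ}
    (hx : x ∈ G.piece l) (hy : y ∈ G.piece l) : lam * |x - y| ≤ |G.ghat x - G.ghat y| :=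
  mul_abs_sub_le_of_le_abs_deriv ordConnected_Ioo
    (fun _ h => (G.hasDerivAt_branch hg h).differentiableAt)
    (fun _ h => G.le_abs_deriv_ghat hg h) hx hy

/-- There are `2 ^ n` binary words of length `n`, and `2 < exp 2`. -/
theorem summable_exp_neg_two_mul_words :
    Summable fun p : Σ n : ℕ, Fin n → Bool => Real.exp (-(2 * p.1 : ℝ)) := by
  rw [summable_sigma_of_nonneg fun _ => (Real.exp_pos _).le]
  refine ⟨fun n => (hasSum_fintype (fun _ : Fin n → Bool => Real.exp (-(2 * n : ℝ)))).summable, ?_⟩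
  have he : ∀ n : ℕ, ∑' _ : Fin n → Bool, Real.exp (-(2 * n : ℝ)) = (2 * Real.exp (-2)) ^ n := by
    intro n
    rw [tsum_fintype, Finset.sum_const, Finset.card_univ, mul_pow, ← Real.exp_nat_mul]
    simp [mul_comm]
  refine Summable.congr ?_ fun n => (he n).symm
  refine summable_geometric_of_lt_one (by positivity) ?_
  have : (2 : ℝ) < Real.exp 2 := by linarith [Real.add_one_lt_exp (x := 2) (by norm_num)]
  rw [Real.exp_neg, ← div_eq_mul_inv, div_lt_one (Real.exp_pos _)]
  exact this

/-- The number of branches with return time `n` is at most `2 ^ n`; hence summability. -/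
theorem summable_exp_neg_two_mul_r (G : ReturnScheme g) (hg : IsExpandingOffZero g lam) :
    Summable fun l => Real.exp (-(2 * G.r l : ℝ)) := by
  classical
  have h0 : (0 : ℝ) ∈ Ioo (-G.δ) G.δ := ⟨by linarith [G.δ_pos], G.δ_pos⟩
  choose z hz hz0 using fun l => (G.full l).surjOn h0
  -- A branch is labelled by the sign word of its preimage of `0`. Fullness of the branches gives
  -- them all the common end point `0`, so equal labels force equal preimages.
  let ι : ℕ → Σ n : ℕ, Fin n → Bool := fun l => ⟨G.r l, fun j => decide (0 < g^[j] (z l))⟩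
  have hι : Function.Injective ι := by
    have key : ∀ l k n (e : Fin n → Bool), ι l = ⟨n, e⟩ → ι k = ⟨n, e⟩ → l = k := by
      intro l k n e hl hk
      obtain ⟨rfl, hl⟩ := Sigma.mk.inj_iff.1 hl
      obtain ⟨hr, hk⟩ := Sigma.mk.inj_iff.1 hk
      have hs : ∀ j < G.r l, 0 < g^[j] (z l) ↔ 0 < g^[j] (z k) := by
        intro j hj
        have e1 := congrFun (eq_of_heq hl) ⟨j, hj⟩
        have e2 : decide (0 < g^[j] (z k)) = e ⟨j, hj⟩ := by
          -- The words have the dependent type `Fin (G.r k) → Bool`; making the length a variable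
          -- allows the substitution.
          clear_value ι
          generalize G.r k = m at hr hk
          subst hr
          exact congrFun (eq_of_heq hk) ⟨j, hj⟩
        simpa using e1.trans e2.symm
      have hzz : z l = z k := by
        refine hg.eq_of_iterate_eq (G.r l) (fun j hj => ⟨G.avoid l _ (hz l) j hj,
          G.abs_iterate_lt_one hg (hz l) hj.le⟩) (fun j hj => ⟨G.avoid k _ (hz k) j (hr ▸ hj),
          G.abs_iterate_lt_one hg (hz k) (hr ▸ hj.le)⟩) hs ?_
        rw [hz0 l, ← hr, hz0 k]
      rw [← G.index_eq (hz l), hzz, G.index_eq (hz k)]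
    intro l k h
    exact key l k _ _ rfl h.symm
  exact (summable_exp_neg_two_mul_words.comp_injective hι :)

end ReturnScheme

/-! ### Finite entropy of the partition. -/

namespace MarkovInduction

variable {g : ℝ → ℝ} {lam : ℝ}

/-- The terms are the integrals of `rhat` over the pieces. -/
theorem summable_r_mul_length (G : MarkovInduction g) :
    Summable fun l => (G.r l : ℝ) * (G.v l - G.u l) := by
  have hsub : (⋃ l, G.piece l) ⊆ G.base := iUnion_subset G.piece_subset_base
  have := (hasSum_integral_iUnion G.measurableSet_piece G.disjoint
    (G.integrable_rhat.mono_set hsub)).summable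
  refine this.congr fun l => ?_
  rw [setIntegral_congr_fun (G.measurableSet_piece l) (g := fun _ => (G.r l : ℝ))
    fun x hx => by simp only [G.rhat_eq hx]]
  rw [setIntegral_const, ReturnScheme.piece, Real.volume_real_Ioo_of_le (G.u_lt_v l).le, smul_eq_mul,
    mul_comm]

theorem length_pos (G : MarkovInduction g) (l : ℕ) : 0 < G.v l - G.u l := sub_pos.2 (G.u_lt_v l)

/-- The partition into the pieces has finite entropy. -/
theorem summable_length_mul_log (G : MarkovInduction g) (hg : IsExpandingOffZero g lam) :
    Summable fun l => (G.v l - G.u l) * |Real.log (G.v l - G.u l)| := by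
  have hmaj := ((G.summable_r_mul_length.mul_left 4).add (G.summable_exp_neg_two_mul_r hg))
  refine Summable.of_nonneg_of_le (fun l => mul_nonneg (G.length_pos l).le (abs_nonneg _))
    (fun l => ?_) hmaj
  have hp := G.length_pos l
  have hr : (1 : ℝ) ≤ G.r l := by exact_mod_cast G.r_pos l
  have hlen : G.v l - G.u l ≤ 2 := by
    have h := (Ioo_subset_Ioo_iff (G.u_lt_v l)).1 (G.subset l)
    linarith [h.1, h.2, G.δ_lt_one]
  set p := G.v l - G.u l
  have he := Real.exp_pos (-(2 * G.r l : ℝ))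
  rcases abs_cases (Real.log p) with ⟨h, -⟩ | ⟨h, -⟩ <;> rw [h]
  · have : Real.log p ≤ 1 := by linarith [Real.log_le_sub_one_of_pos hp]
    nlinarith
  -- With `t = exp (-2 r) / p`, the inequality `log t ≤ t - 1` gives `-p log p ≤ 2 r p + exp (-2 r)
  -- - p`.
  · have h1 := Real.log_le_sub_one_of_pos (div_pos he hp)
    rw [Real.log_div he.ne' hp.ne', Real.log_exp] at h1
    have h2 : p * (Real.exp (-(2 * G.r l : ℝ)) / p) = Real.exp (-(2 * G.r l : ℝ)) := by field_simp
    nlinarith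
end MarkovInduction

/-! ### Cylinders and bounded distortion. -/

namespace ReturnScheme

variable {g : ℝ → ℝ} {lam : ℝ}

/-- The cylinder of the points whose itinerary starts with the first `n` symbols of `v`. -/
def cyl (G : ReturnScheme g) (n : ℕ) (v : ℕ → ℕ) : Set ℝ :=
  {x | x ∈ G.base ∧ ∀ i < n, G.ghat^[i] x ∈ G.piece (v i)}

theorem iterate_mem_base (G : ReturnScheme g) {n : ℕ} {v : ℕ → ℕ} {x : ℝ} (hx : x ∈ G.cyl n v) :
    G.ghat^[n] x ∈ G.base := by
  cases n with
  | zero => exact hx.1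
  | succ n =>
    rw [Function.iterate_succ_apply']
    exact (G.bijOn_ghat (v n)).mapsTo (hx.2 n n.lt_succ_self)

/-- Each common symbol contributes a factor `lam`. It makes cylinders of order `n` exponentially
short, the iterate injective on them, and the first coordinate of a coded point unique. -/
theorem pow_mul_abs_sub_le (G : ReturnScheme g) (hg : IsExpandingOffZero g lam) {n : ℕ}
    {v : ℕ → ℕ} {x y : ℝ} (hx : ∀ i < n, G.ghat^[i] x ∈ G.piece (v i))
    (hy : ∀ i < n, G.ghat^[i] y ∈ G.piece (v i)) :
    lam ^ n * |x - y| ≤ |G.ghat^[n] x - G.ghat^[n] y| := by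
  have h1 := hg.one_lt
  induction n with
  | zero => simp
  | succ n ih =>
    rw [Function.iterate_succ_apply', Function.iterate_succ_apply']
    have hn := n.lt_succ_self
    have h2 := ih (fun i hi => hx i (hi.trans hn)) (fun i hi => hy i (hi.trans hn))
    calc lam ^ (n + 1) * |x - y| = lam * (lam ^ n * |x - y|) := by ring
      _ ≤ lam * |G.ghat^[n] x - G.ghat^[n] y| := by gcongr
      _ ≤ _ := G.mul_abs_sub_le hg (hx n hn) (hy n hn)

theorem injOn_cyl (G : ReturnScheme g) (hg : IsExpandingOffZero g lam) (n : ℕ) (v : ℕ → ℕ) :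
    InjOn G.ghat^[n] (G.cyl n v) := by
  intro x hx y hy e
  have h := G.pow_mul_abs_sub_le hg hx.2 hy.2
  have h1 : 0 < lam ^ n := pow_pos (by linarith [hg.one_lt]) n
  rw [e, sub_self, abs_zero] at h
  have h0 : |x - y| = 0 := le_antisymm (by nlinarith [abs_nonneg (x - y)]) (abs_nonneg _)
  linarith [abs_eq_zero.1 h0]

theorem surjOn_cyl (G : ReturnScheme g) (n : ℕ) (v : ℕ → ℕ) :
    SurjOn G.ghat^[n] (G.cyl n v) G.base := by
  induction n generalizing v with
  | zero => exact fun t ht => ⟨t, ⟨ht, by simp⟩, rfl⟩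
  | succ n ih =>
    intro t ht
    obtain ⟨x', hx', rfl⟩ := ih (fun i => v (i + 1)) ht
    obtain ⟨x, hx, rfl⟩ := (G.bijOn_ghat (v 0)).surjOn hx'.1
    refine ⟨x, ⟨G.piece_subset_base _ hx, ?_⟩, rfl⟩
    rintro (_ | i) hi
    · exact hx
    · exact hx'.2 i (Nat.lt_of_succ_lt_succ hi)

theorem measurableSet_cyl (G : ReturnScheme g) (hm : Measurable G.ghat) (n : ℕ) (v : ℕ → ℕ) :
    MeasurableSet (G.cyl n v) := by
  have : G.cyl n v = G.base ∩ ⋂ i, ⋂ (_ : i < n), G.ghat^[i] ⁻¹' G.piece (v i) := by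
    ext x; simp [cyl]
  rw [this]
  exact G.measurableSet_base.inter (.iInter fun i => .iInter fun _ =>
    hm.iterate i (G.measurableSet_piece _))

/-- Extension of a finite word by zeros. -/
def extendWord {n : ℕ} (f : Fin n → ℕ) (i : ℕ) : ℕ := if h : i < n then f ⟨i, h⟩ else 0

theorem pairwise_disjoint_cyl (G : ReturnScheme g) (n : ℕ) :
    Pairwise (Function.onFun Disjoint fun f : Fin n → ℕ => G.cyl n (extendWord f)) := by
  intro f f' hne
  refine Set.disjoint_left.2 fun x hx hx' => hne (funext fun i => ?_)
  have h1 := G.index_eq (hx.2 i i.2)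
  have h2 := G.index_eq (hx'.2 i i.2)
  simp only [extendWord, i.2, dif_pos] at h1 h2
  exact h1.symm.trans h2

theorem mem_iUnion_cyl (G : ReturnScheme g) {n : ℕ} {x : ℝ} (hx : x ∈ G.base)
    (h : ∀ i < n, ∃ l, G.ghat^[i] x ∈ G.piece l) :
    x ∈ ⋃ f : Fin n → ℕ, G.cyl n (extendWord f) := by
  refine mem_iUnion.2 ⟨fun i => G.index (G.ghat^[i] x), hx, fun i hi => ?_⟩
  obtain ⟨l, hl⟩ := h i hi
  simpa [extendWord, hi, G.index_eq hl] using hl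

theorem hasDerivAt_iterate_ghat (G : ReturnScheme g) (hg : IsExpandingOffZero g lam) {n : ℕ}
    {v : ℕ → ℕ} {x : ℝ} (hx : x ∈ G.cyl n v) :
    HasDerivAt G.ghat^[n] (∏ i ∈ Finset.range n, deriv G.ghat (G.ghat^[i] x)) x :=
  hasDerivAt_iterate_prod n fun i hi => (G.hasDerivAt_branch hg (hx.2 i hi)).differentiableAt

end ReturnScheme

namespace MarkovInduction

variable {g : ℝ → ℝ} {lam : ℝ}

theorem abs_deriv_ghat_le (G : MarkovInduction g) (hg : IsExpandingOffZero g lam) {n : ℕ}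
    (hn : 1 ≤ n) {x y : ℝ}
    (h : ∀ i < n, ∃ l, G.ghat^[i] x ∈ G.piece l ∧ G.ghat^[i] y ∈ G.piece l) :
    |deriv G.ghat x| ≤ Real.exp (G.C * G.c ^ n) * |deriv G.ghat y| := by
  obtain ⟨l, hx, hy⟩ := h 0 hn
  rw [Function.iterate_zero_apply] at hx hy
  have h1 := hg.one_lt
  have hx' := G.le_abs_deriv_ghat hg hx
  have hy' := G.le_abs_deriv_ghat hg hy
  have hd := G.distortion n x y hn h
  rw [Real.log_le_iff_le_exp (div_pos (by linarith) (by linarith)), div_le_iff₀ (by linarith)] at hd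
  exact hd

/-- The sign of `C` is not assumed; it follows from the distortion bound for `x = y` and `n = 1`. -/
theorem C_nonneg (G : MarkovInduction g) (hg : IsExpandingOffZero g lam) : 0 ≤ G.C := by
  obtain ⟨x, hx⟩ := nonempty_Ioo.2 (G.u_lt_v 0)
  have h := G.distortion 1 x x le_rfl fun i hi => ⟨0, by
    obtain rfl : i = 0 := by omega
    exact ⟨hx, hx⟩⟩
  have h1 := hg.one_lt
  have h2 := G.le_abs_deriv_ghat hg hx
  rw [div_self (by linarith), Real.log_one, pow_one] at h
  exact nonneg_of_mul_nonneg_left h G.c_pos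

/-- Bound for the distortion of the iterates of the return map. -/
def distortionBound (G : MarkovInduction g) : ℝ := Real.exp (G.C * (1 - G.c)⁻¹)

/-- At time `i` the two orbits still share `n - i` symbols, so the logarithms of the ratios of the
factors are bounded by a geometric series, independently of `n`. -/
theorem abs_prod_deriv_le (G : MarkovInduction g) (hg : IsExpandingOffZero g lam) {n : ℕ}
    {v : ℕ → ℕ} {x y : ℝ} (hx : x ∈ G.cyl n v) (hy : y ∈ G.cyl n v) :
    |∏ i ∈ Finset.range n, deriv G.ghat (G.ghat^[i] x)| ≤
      G.distortionBound * |∏ i ∈ Finset.range n, deriv G.ghat (G.ghat^[i] y)| := by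
  have hC := G.C_nonneg hg
  have hstep : ∀ i ∈ Finset.range n, |deriv G.ghat (G.ghat^[i] x)| ≤
      Real.exp (G.C * G.c ^ (n - i)) * |deriv G.ghat (G.ghat^[i] y)| := by
    intro i hi
    rw [Finset.mem_range] at hi
    refine G.abs_deriv_ghat_le hg (by omega) fun k hk => ⟨v (k + i), ?_⟩
    rw [← Function.iterate_add_apply, ← Function.iterate_add_apply]
    exact ⟨hx.2 _ (by omega), hy.2 _ (by omega)⟩
  have hsum : ∑ i ∈ Finset.range n, G.C * G.c ^ (n - i) ≤ G.C * (1 - G.c)⁻¹ := by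
    rw [← Finset.mul_sum]
    refine mul_le_mul_of_nonneg_left ?_ hC
    have hc := G.c_lt_one
    have hc0 := G.c_pos
    rw [← tsum_geometric_of_lt_one hc0.le hc]
    -- One factor `c` is given up so that the exponents `n - 1 - i` run through `0, …, n - 1`.
    calc ∑ i ∈ Finset.range n, G.c ^ (n - i)
        ≤ ∑ i ∈ Finset.range n, G.c ^ (n - 1 - i) := Finset.sum_le_sum fun i _ =>
          pow_le_pow_of_le_one hc0.le hc.le (by omega)
      _ = ∑ i ∈ Finset.range n, G.c ^ i := Finset.sum_range_reflect (fun i => G.c ^ i) n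
      _ ≤ _ := (summable_geometric_of_lt_one hc0.le hc).sum_le_tsum _
        fun i _ => (pow_pos hc0 i).le
  rw [Finset.abs_prod, Finset.abs_prod]
  calc _ ≤ ∏ i ∈ Finset.range n, (Real.exp (G.C * G.c ^ (n - i)) *
          |deriv G.ghat (G.ghat^[i] y)|) := Finset.prod_le_prod (fun _ _ => abs_nonneg _) hstep
    _ = Real.exp (∑ i ∈ Finset.range n, G.C * G.c ^ (n - i)) *
          ∏ i ∈ Finset.range n, |deriv G.ghat (G.ghat^[i] y)| := by
        rw [Finset.prod_mul_distrib, Real.exp_sum]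
    _ ≤ _ := mul_le_mul_of_nonneg_right (Real.exp_le_exp.2 hsum)
        (Finset.prod_nonneg fun _ _ => abs_nonneg _)

/-- The constant in the estimate of the conditional probability of a return to a set. -/
def mixingConst (G : MarkovInduction g) : ENNReal :=
  ENNReal.ofReal (G.distortionBound ^ 2 / (2 * G.δ))

/-- The iterate maps the cylinder bijectively onto the base, with a Jacobian constant up to the
factor `D`. Comparing both the part over `A` and the whole cylinder with the Jacobian at one point
`y` costs `D` twice, whence `D ^ 2 / (2 δ)`. -/
theorem volume_cyl_inter_preimage_le (G : MarkovInduction g) (hg : IsExpandingOffZero g lam)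
    (hm : Measurable G.ghat) (n : ℕ) (v : ℕ → ℕ) {A : Set ℝ} (hA : MeasurableSet A) :
    volume (G.cyl n v ∩ G.ghat^[n] ⁻¹' A) ≤ G.mixingConst * volume A * volume (G.cyl n v) := by
  have hδ := G.δ_pos
  obtain ⟨y, hy, -⟩ := G.surjOn_cyl n v (show (0 : ℝ) ∈ G.base from ⟨by linarith, hδ⟩)
  set D := G.distortionBound with hDdef
  have hD : 0 < D := Real.exp_pos _
  set J : ℝ → ℝ := fun x => ∏ i ∈ Finset.range n, deriv G.ghat (G.ghat^[i] x) with hJ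
  have hJD : ∀ x ∈ G.cyl n v, ∀ y ∈ G.cyl n v, |J x| ≤ D * |J y| :=
    fun x hx y hy => G.abs_prod_deriv_le hg hx hy
  have hm0 : 0 < |J y| := by
    refine abs_pos.2 (Finset.prod_ne_zero_iff.2 fun i hi h => ?_)
    have := G.le_abs_deriv_ghat hg (hy.2 i (Finset.mem_range.1 hi))
    rw [h, abs_zero] at this
    linarith [hg.one_lt]
  have hZ := G.measurableSet_cyl hm n v
  have hS : MeasurableSet (G.cyl n v ∩ G.ghat^[n] ⁻¹' A) := hZ.inter (hm.iterate n hA)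
  have hvol : ∀ S ⊆ G.cyl n v, MeasurableSet S →
      volume (G.ghat^[n] '' S) = ∫⁻ x in S, ENNReal.ofReal |J x| := by
    intro S hSZ hSm
    have := lintegral_image_eq_lintegral_abs_deriv_mul hSm
      (fun x hx => (G.hasDerivAt_iterate_ghat hg (hSZ hx)).hasDerivWithinAt)
      ((G.injOn_cyl hg n v).mono hSZ) (fun _ => 1)
    simpa using this
  have h1 : ENNReal.ofReal (|J y| / D) * volume (G.cyl n v ∩ G.ghat^[n] ⁻¹' A) ≤ volume A := by
    rw [← setLIntegral_const]
    calc _ ≤ ∫⁻ x in G.cyl n v ∩ G.ghat^[n] ⁻¹' A, ENNReal.ofReal |J x| :=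
          setLIntegral_mono' hS fun x hx => ENNReal.ofReal_le_ofReal <| by
            rw [div_le_iff₀' hD]; exact hJD y hy x hx.1
      _ = _ := (hvol _ inter_subset_left hS).symm
      _ ≤ _ := measure_mono (image_subset_iff.2 inter_subset_right)
  have h2 : ENNReal.ofReal (2 * G.δ) ≤ ENNReal.ofReal (D * |J y|) * volume (G.cyl n v) := by
    rw [← setLIntegral_const]
    calc _ = volume G.base := by
          rw [ReturnScheme.base, Real.volume_Ioo]; congr 1; ring
      _ ≤ volume (G.ghat^[n] '' G.cyl n v) := measure_mono (G.surjOn_cyl n v)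
      _ = ∫⁻ x in G.cyl n v, ENNReal.ofReal |J x| := hvol _ subset_rfl hZ
      _ ≤ _ := setLIntegral_mono' hZ fun x hx => ENNReal.ofReal_le_ofReal (hJD x hx y hy)
  set V := volume (G.cyl n v ∩ G.ghat^[n] ⁻¹' A)
  calc V = ENNReal.ofReal (D / |J y|) * (ENNReal.ofReal (|J y| / D) * V) := by
        rw [← mul_assoc, ← ENNReal.ofReal_mul (by positivity)]
        rw [show D / |J y| * (|J y| / D) = 1 by field_simp]; simp
    _ ≤ ENNReal.ofReal (D / |J y|) * volume A := by gcongr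
    _ = ENNReal.ofReal (D / |J y|) * volume A *
          (ENNReal.ofReal (1 / (2 * G.δ)) * ENNReal.ofReal (2 * G.δ)) := by
        rw [← ENNReal.ofReal_mul (by positivity)]
        rw [show 1 / (2 * G.δ) * (2 * G.δ) = 1 by field_simp]; simp
    _ ≤ ENNReal.ofReal (D / |J y|) * volume A *
          (ENNReal.ofReal (1 / (2 * G.δ)) * (ENNReal.ofReal (D * |J y|) * volume (G.cyl n v))) := by
        gcongr
    _ = (ENNReal.ofReal (D / |J y|) * ENNReal.ofReal (1 / (2 * G.δ)) * ENNReal.ofReal (D * |J y|)) *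
          volume A * volume (G.cyl n v) := by ring
    _ = _ := by
        rw [← ENNReal.ofReal_mul (by positivity), ← ENNReal.ofReal_mul (by positivity), mixingConst]
        congr 3
        rw [← hDdef]
        field_simp

end MarkovInduction

/-! ### Boundedness of the invariant density. -/

theorem exists_continuous_approx_density {μ : Measure ℝ} [IsProbabilityMeasure μ] (hμ : μ ≪ volume)
    {ε : NNReal} (hε : ε ≠ 0) : ∃ φ : ℝ → ℝ, Continuous φ ∧ ∫⁻ x, ‖φ x‖ₑ ≤ 1 + ε ∧
      ∀ B, μ B ≤ (∫⁻ x in B, ‖φ x‖ₑ) + ε := by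
  obtain ⟨φ, -, hφ, hc, -⟩ := (Measure.integrable_toReal_rnDeriv (μ := μ)
    (ν := volume)).exists_hasCompactSupport_lintegral_sub_le (ENNReal.coe_ne_zero.2 hε)
  have he : ∀ᵐ x, ‖(μ.rnDeriv volume x).toReal‖ₑ = μ.rnDeriv volume x := by
    filter_upwards [μ.rnDeriv_ne_top volume] with x hx
    rw [Real.enorm_eq_ofReal ENNReal.toReal_nonneg, ENNReal.ofReal_toReal hx]
  have hφm : Measurable fun x => ‖φ x‖ₑ := hc.measurable.enorm
  refine ⟨φ, hc, ?_, fun B => ?_⟩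
  · calc ∫⁻ x, ‖φ x‖ₑ ≤ ∫⁻ x, (μ.rnDeriv volume x + ‖(μ.rnDeriv volume x).toReal - φ x‖ₑ) := by
          refine lintegral_mono_ae ?_
          filter_upwards [he] with x hx
          rw [← hx, enorm_sub_rev]
          simpa using enorm_add_le (μ.rnDeriv volume x).toReal (φ x - (μ.rnDeriv volume x).toReal)
      _ = (∫⁻ x, μ.rnDeriv volume x) + ∫⁻ x, ‖(μ.rnDeriv volume x).toReal - φ x‖ₑ :=
          lintegral_add_left (Measure.measurable_rnDeriv _ _) _
      _ ≤ _ := by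
          refine add_le_add ?_ hφ
          rw [← setLIntegral_univ, Measure.setLIntegral_rnDeriv hμ]
          exact prob_le_one
  · rw [← Measure.setLIntegral_rnDeriv hμ]
    calc _ ≤ ∫⁻ x in B, (‖φ x‖ₑ + ‖(μ.rnDeriv volume x).toReal - φ x‖ₑ) := by
          refine lintegral_mono_ae ?_
          filter_upwards [ae_restrict_of_ae he] with x hx
          rw [← hx]
          simpa using enorm_add_le (φ x) ((μ.rnDeriv volume x).toReal - φ x)
      _ = _ := lintegral_add_left hφm _
      _ ≤ _ := by gcongr; exact (setLIntegral_le_lintegral _ _).trans hφ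

namespace IsACErgodic

variable {g : ℝ → ℝ} {lam : ℝ} {G : MarkovInduction g} {μhat : Measure ℝ}

theorem ae_mem_iUnion_piece (h : IsACErgodic G μhat) : ∀ᵐ x ∂μhat, x ∈ G.base ∧ ∃ l, x ∈ G.piece l := by
  have h1 : ∀ᵐ x ∂μhat, x ∈ G.base := h.base
  have h2 : ∀ᵐ x ∂μhat, x ∉ Ioo (-G.δ) G.δ \ ⋃ l, Ioo (G.u l) (G.v l) :=
    measure_eq_zero_iff_ae_notMem.1 (h.ac G.cover)
  filter_upwards [h1, h2] with x hx hx'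
  refine ⟨hx, ?_⟩
  by_contra hcon
  exact hx' ⟨hx, fun hm => hcon (mem_iUnion.1 hm)⟩

theorem ae_iterate_mem (h : IsACErgodic G μhat) (n : ℕ) :
    ∀ᵐ x ∂μhat, x ∈ G.base ∧ ∀ i < n, ∃ l, G.ghat^[i] x ∈ G.piece l := by
  have h1 : ∀ᵐ x ∂μhat, ∀ i, ∃ l, G.ghat^[i] x ∈ G.piece l := by
    rw [ae_all_iff]
    intro i
    exact ((h.ergodic.toMeasurePreserving.iterate i).quasiMeasurePreserving.ae
      h.ae_mem_iUnion_piece).mono fun x hx => hx.2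
  filter_upwards [h1, h.ae_mem_iUnion_piece] with x hx hx' using ⟨hx'.1, fun i _ => hx i⟩

/-- By invariance `A` may be replaced by its preimage under `ghat^[n]`. For large `n` a continuous
`L¹` approximation `φ` of the density is nearly constant on each cylinder of order `n`, where the
preimage occupies a proportion at most `mixingConst * volume A`. -/
theorem measure_le_of_approx (h : IsACErgodic G μhat) (hg : IsExpandingOffZero g lam) {A : Set ℝ}
    (hA : MeasurableSet A) {ε : NNReal} (hε : 0 < ε) :
    μhat A ≤ G.mixingConst * volume A * (1 + 5 * ε) + ε := by
  have := h.prob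
  have hm : Measurable G.ghat := h.ergodic.measurable
  obtain ⟨φ, hφ, hφ1, hφμ⟩ := exists_continuous_approx_density h.ac hε.ne'
  have h1 := hg.one_lt
  have hδ := G.δ_pos
  have hδ1 := G.δ_lt_one
  obtain ⟨η, hη, hosc⟩ := Metric.uniformContinuousOn_iff.1
    ((isCompact_Icc (a := (-1 : ℝ)) (b := 1)).uniformContinuousOn_of_continuous hφ.continuousOn)
    ε hε
  -- Cylinders of order `n` have diameter at most `2 / lam ^ n`, which is now below the modulus of
  -- continuity `η`.
  obtain ⟨n, hn⟩ := pow_unbounded_of_one_lt (2 / η) h1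
  have hosc' : ∀ v, ∀ x ∈ G.cyl n v, ∀ y ∈ G.cyl n v, ‖φ x‖ₑ ≤ ‖φ y‖ₑ + ε := by
    intro v x hx y hy
    have hb : ∀ z ∈ G.base, z ∈ Icc (-1 : ℝ) 1 := fun z hz =>
      ⟨by linarith [hz.1], by linarith [hz.2]⟩
    have hxy : dist x y < η := by
      have e1 := G.pow_mul_abs_sub_le hg hx.2 hy.2
      have hx' := hb _ (G.iterate_mem_base hx)
      have hy' := hb _ (G.iterate_mem_base hy)
      have e2 : |G.ghat^[n] x - G.ghat^[n] y| ≤ 2 :=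
        abs_le.2 ⟨by linarith [hx'.1, hy'.2], by linarith [hx'.2, hy'.1]⟩
      rw [div_lt_iff₀ hη] at hn
      rw [Real.dist_eq]
      have : 0 < lam ^ n := by positivity
      by_contra hcon
      nlinarith [mul_le_mul_of_nonneg_left (not_lt.1 hcon) this.le]
    have hd := hosc x (hb x hx.1) y (hb y hy.1) hxy
    have hd' : ‖φ x - φ y‖ₑ ≤ ε := by
      rw [← ofReal_norm, ← dist_eq_norm, ENNReal.ofReal_le_iff_le_toReal (by simp)]
      exact hd.le
    calc ‖φ x‖ₑ = ‖φ y + (φ x - φ y)‖ₑ := by simp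
      _ ≤ _ := (enorm_add_le _ _).trans (by gcongr)
  set K := G.mixingConst * volume A with hK
  have hZ := fun v => G.measurableSet_cyl hm n v
  -- One `ε` is lost in replacing `φ x` by `φ y`, another in returning to `φ x`.
  have hcyl : ∀ v, ∫⁻ x in G.cyl n v ∩ G.ghat^[n] ⁻¹' A, ‖φ x‖ₑ ≤
      K * ∫⁻ x in G.cyl n v, (‖φ x‖ₑ + 2 * ε) := by
    intro v
    obtain ⟨y, hy, -⟩ := G.surjOn_cyl n v (show (0 : ℝ) ∈ G.base from ⟨by linarith, hδ⟩)
    calc _ ≤ ∫⁻ x in G.cyl n v ∩ G.ghat^[n] ⁻¹' A, (‖φ y‖ₑ + ε) :=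
          setLIntegral_mono' ((hZ v).inter (hm.iterate n hA)) fun x hx => hosc' v x hx.1 y hy
      _ = (‖φ y‖ₑ + ε) * volume (G.cyl n v ∩ G.ghat^[n] ⁻¹' A) := setLIntegral_const _ _
      _ ≤ (‖φ y‖ₑ + ε) * (K * volume (G.cyl n v)) := by
          gcongr; exact G.volume_cyl_inter_preimage_le hg hm n v hA
      _ = K * ∫⁻ x in G.cyl n v, (‖φ y‖ₑ + ε) := by rw [setLIntegral_const]; ring
      _ ≤ _ := by
          gcongr 1
          refine setLIntegral_mono' (hZ v) fun x hx => ?_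
          rw [two_mul, ← add_assoc]
          gcongr
          exact hosc' v y hy x hx
  have hvolbase : volume G.base ≤ 2 := by
    rw [ReturnScheme.base, Real.volume_Ioo]
    refine (ENNReal.ofReal_le_ofReal (show G.δ - -G.δ ≤ 2 by linarith)).trans (by simp)
  calc μhat A = μhat (G.ghat^[n] ⁻¹' A) :=
        ((h.ergodic.toMeasurePreserving.iterate n).measure_preimage hA.nullMeasurableSet).symm
    _ ≤ μhat (⋃ f : Fin n → ℕ, G.cyl n (ReturnScheme.extendWord f) ∩ G.ghat^[n] ⁻¹' A) := by
        refine measure_mono_ae ?_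
        filter_upwards [h.ae_iterate_mem n] with x hx hxA
        rw [← iUnion_inter]
        exact ⟨G.mem_iUnion_cyl hx.1 hx.2, hxA⟩
    _ ≤ (∫⁻ x in ⋃ f : Fin n → ℕ, G.cyl n (ReturnScheme.extendWord f) ∩ G.ghat^[n] ⁻¹' A,
          ‖φ x‖ₑ) + ε := hφμ _
    _ ≤ (∑' f : Fin n → ℕ, K * ∫⁻ x in G.cyl n (ReturnScheme.extendWord f),
          (‖φ x‖ₑ + 2 * ε)) + ε := by
        gcongr
        exact (lintegral_iUnion_le _ _).trans (ENNReal.tsum_le_tsum fun f => hcyl _)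
    _ = K * (∫⁻ x in ⋃ f : Fin n → ℕ, G.cyl n (ReturnScheme.extendWord f),
          (‖φ x‖ₑ + 2 * ε)) + ε := by
        rw [ENNReal.tsum_mul_left, lintegral_iUnion (fun f => hZ _) (G.pairwise_disjoint_cyl n)]
    _ ≤ K * (∫⁻ x in G.base, (‖φ x‖ₑ + 2 * ε)) + ε := by
        gcongr
        exact iUnion_subset fun f x hx => hx.1
    -- `φ` has `L¹` norm at most `1 + ε`, and the error `2 ε` is integrated over a base of length at
    -- most `2`.
    _ ≤ K * (1 + 5 * ε) + ε := by
        gcongr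
        rw [lintegral_add_right _ measurable_const, setLIntegral_const]
        calc _ ≤ (1 + (ε : ENNReal)) + 2 * ε * 2 := by
              gcongr
              exact (setLIntegral_le_lintegral _ _).trans hφ1
          _ = _ := by ring

/-- The density of an absolutely continuous invariant probability of the return map is bounded. -/
theorem measure_le (h : IsACErgodic G μhat) (hg : IsExpandingOffZero g lam) {A : Set ℝ}
    (hA : MeasurableSet A) (hA' : volume A ≠ ⊤) : μhat A ≤ G.mixingConst * volume A := by
  have hK : G.mixingConst * volume A ≠ ⊤ := ENNReal.mul_ne_top ENNReal.ofReal_ne_top hA'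
  have hc : Continuous fun ε : ENNReal => G.mixingConst * volume A * (1 + 5 * ε) + ε :=
    ((ENNReal.continuous_const_mul hK).comp
      (continuous_const.add (ENNReal.continuous_const_mul (by simp)))).add continuous_id
  have ht : Tendsto (fun ε : NNReal => G.mixingConst * volume A * (1 + 5 * (ε : ENNReal)) + ε)
      (𝓝[>] 0) (𝓝 (G.mixingConst * volume A * (1 + 5 * ((0 : NNReal) : ENNReal)) + (0 : NNReal))) :=
    ((hc.comp ENNReal.continuous_coe).tendsto 0).mono_left nhdsWithin_le_nhds
  rw [ENNReal.coe_zero, mul_zero, add_zero, add_zero, mul_one] at ht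
  refine ge_of_tendsto ht ?_
  filter_upwards [self_mem_nhdsWithin] with ε hε using h.measure_le_of_approx hg hA hε

end IsACErgodic

/-! ### Return time and derivative near the singularity. -/

theorem ContDiffAt.continuousAt_deriv_of_infty {f : ℝ → ℝ} {x : ℝ} (h : ContDiffAt ℝ ∞ f x) :
    ContinuousAt (deriv f) x := by
  have h1 : ContDiffAt ℝ 0 (fderiv ℝ f) x := h.fderiv_right (by simp)
  exact h1.continuousAt.clm_apply continuousAt_const

namespace LorenzSaddle

variable {M : Type*} [TopologicalSpace M]
    [ChartedSpace (EuclideanSpace ℝ (Fin 3)) M] [IsManifold (𝓡 3) ∞ M]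

theorem αu_pos (D : LorenzSaddle M) : 0 < D.αu := by linarith [D.αs_neg, D.αs_add_αu]

theorem ρ_pos (D : LorenzSaddle M) : 0 < D.ρ := by linarith [D.one_lt_ρ]

theorem exponent_pos (D : LorenzSaddle M) : 0 < -D.αs / D.αu :=
  div_pos (by linarith [D.αs_neg]) D.αu_pos

theorem exponent_lt_one (D : LorenzSaddle M) : -D.αs / D.αu < 1 := by
  rw [div_lt_one D.αu_pos]; linarith [D.αs_add_αu]

theorem strong_exponent_pos (D : LorenzSaddle M) : 0 < -D.αss / D.αu :=
  div_pos (by linarith [D.αs_neg, D.αss_lt]) D.αu_pos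

theorem exitZ_lt (D : LorenzSaddle M) {x : ℝ} (h1 : |x| < 1) :
    D.exitZ x < D.exitZ 1 := by
  have := D.ρ_pos
  refine Real.rpow_lt_rpow (by positivity) ?_ D.exponent_pos
  rw [abs_one]
  gcongr

theorem zero_mem_exitRegion (D : LorenzSaddle M) {z : ℝ} (hz : z ∈ Icc 0 (D.exitZ 1)) :
    ((0 : ℝ), z) ∈ D.exitRegion := ⟨hz, by simpa using Real.rpow_nonneg hz.1 _⟩

theorem continuous_exitZ (D : LorenzSaddle M) : Continuous D.exitZ :=
  (continuous_abs.div_const _).rpow_const fun _ => Or.inr D.exponent_pos.le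

theorem continuous_exitY (D : LorenzSaddle M) : Continuous fun p : ℝ × ℝ => D.exitY p.1 p.2 :=
  continuous_snd.mul ((continuous_fst.abs.div_const _).rpow_const
    fun _ => Or.inr D.strong_exponent_pos.le)

theorem isCompact_exitRegion (D : LorenzSaddle M) : IsCompact D.exitRegion := by
  have he : 0 ≤ D.αss / D.αs :=
    div_nonneg_of_nonpos (by linarith [D.αs_neg, D.αss_lt]) D.αs_neg.le
  set B := (D.exitZ 1) ^ (D.αss / D.αs)
  refine (isCompact_Icc (a := ((-B, 0) : ℝ × ℝ)) (b := (B, D.exitZ 1))).of_isClosed_subset ?_ ?_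
  · exact (isClosed_Icc.preimage continuous_snd).inter
      (isClosed_le continuous_fst.abs (continuous_snd.rpow_const fun _ => Or.inr he))
  · rintro ⟨y, z⟩ ⟨⟨h0, h1⟩, hy⟩
    have hB := abs_le.1 (hy.trans (Real.rpow_le_rpow h0 h1 he))
    exact ⟨⟨hB.1, h0⟩, ⟨hB.2, h1⟩⟩

theorem hasDerivAt_exitZ (D : LorenzSaddle M) {x : ℝ} (hx : x ≠ 0) :
    ∃ d, HasDerivAt D.exitZ d x ∧
      Real.log |d| = Real.log (-D.αs / D.αu / D.ρ) +
        (1 - -D.αs / D.αu) * Real.log (D.ρ / |x|) := by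
  have hρ := D.ρ_pos
  have hκ := D.exponent_pos
  have hx' := abs_pos.2 hx
  have h := ((hasDerivAt_abs hx).div_const D.ρ).rpow_const (p := -D.αs / D.αu)
    (Or.inl (by positivity))
  refine ⟨_, h, ?_⟩
  have hs : |((SignType.sign x : SignType) : ℝ)| = 1 := by
    rcases hx.lt_or_gt with h | h <;> simp [h]
  rw [abs_mul, abs_mul, abs_div, hs, abs_of_pos hκ, abs_of_pos hρ,
    abs_of_pos (Real.rpow_pos_of_pos (by positivity) _),
    Real.log_mul (by positivity) (Real.rpow_pos_of_pos (by positivity) _).ne',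
    Real.log_rpow (by positivity), ← inv_div D.ρ |x|, Real.log_inv]
  rw [show 1 / D.ρ * (-D.αs / D.αu) = -D.αs / D.αu / D.ρ by ring]
  ring

theorem R_nonneg (D : LorenzSaddle M) (q : M) : 0 ≤ D.R q := Real.sInf_nonneg fun _ h => h.1.le

/-- The singularity is a fixed point. -/
theorem P_singularity (D : LorenzSaddle M) : D.P (D.pt 0 0 0) = D.pt 0 0 0 := by
  have hρ := D.ρ_pos
  have := D.linear 0 0 0 (D.R (D.pt 0 0 0)) (D.R_nonneg _) (fun s _ => by simpa using hρ.le)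
  simpa [P, pt] using this

theorem sec_injOn (D : LorenzSaddle M) {x y x' y' : ℝ} (hx : |x| ≤ 1) (hy : |y| ≤ 1)
    (hx' : |x'| ≤ 1) (hy' : |y'| ≤ 1) (e : D.sec x y = D.sec x' y') : x = x' ∧ y = y' := by
  have hρ := D.one_lt_ρ
  have e' := D.chart.symm.injOn
    (by simpa using D.box_subset x y 1 (by linarith) hy (by simp))
    (by simpa using D.box_subset x' y' 1 (by linarith) hy' (by simp)) e
  exact ⟨by simpa using congrArg (fun w : EuclideanSpace ℝ (Fin 3) => w 0) e',
    by simpa using congrArg (fun w : EuclideanSpace ℝ (Fin 3) => w 1) e'⟩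

end LorenzSaddle

theorem sign_eq_one_or {x : ℝ} (h0 : 0 < |x|) : Real.sign x = 1 ∨ Real.sign x = -1 := by
  rcases lt_or_gt_of_ne (abs_pos.1 h0) with h | h
  · exact Or.inr (Real.sign_of_neg h)
  · exact Or.inl (Real.sign_of_pos h)

theorem eventually_sign_eq {x : ℝ} (h0 : 0 < |x|) : ∀ᶠ t in 𝓝 x, Real.sign t = Real.sign x := by
  rcases lt_or_gt_of_ne (abs_pos.1 h0) with h | h
  · filter_upwards [gt_mem_nhds h] with t ht
    rw [Real.sign_of_neg h, Real.sign_of_neg ht]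
  · filter_upwards [lt_mem_nhds h] with t ht
    rw [Real.sign_of_pos h, Real.sign_of_pos ht]

namespace GeometricLorenzFlow

variable {M : Type*} [TopologicalSpace M]
    [ChartedSpace (EuclideanSpace ℝ (Fin 3)) M] [IsManifold (𝓡 3) ∞ M]

/-- The strict bound `|g x| < 1` holds because `a` takes values in `[-1, 1]`: the value `±1` at an
interior `z` would be a local extremum, contradicting `a' ≠ 0`. -/
theorem isExpandingOffZero (F : GeometricLorenzFlow M) : IsExpandingOffZero F.g F.θ⁻¹ where
  one_lt := lt_trans (by rw [Real.lt_sqrt zero_le_one]; norm_num) F.sqrt_two_lt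
  le_abs_deriv := F.expanding
  abs_lt_one x h0 h1 := by
    have hs := sign_eq_one_or h0
    obtain ⟨hz0, hz1, -⟩ := F.exitZ_mem h0 h1.le
    have hz2 := F.exitZ_lt h1
    have hnhds : Icc 0 (F.exitZ 1) ∈ 𝓝 (F.exitZ x) := Icc_mem_nhds hz0 hz2
    have hne := (F.a_smooth _ hs _ ⟨hz0.le, hz1⟩).2
    have hr : ∀ z ∈ Icc 0 (F.exitZ 1), F.a (Real.sign x) z ∈ Icc (-1 : ℝ) 1 := fun z hz =>
      (F.landing _ hs _ (F.zero_mem_exitRegion hz)).1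
    have hx := hr _ ⟨hz0.le, hz1⟩
    change |F.a (Real.sign x) (F.exitZ x)| < 1
    rw [abs_lt]
    constructor
    · refine lt_of_le_of_ne hx.1 fun e => hne (IsLocalMin.deriv_eq_zero ?_)
      filter_upwards [hnhds] with z hz
      rw [← e]; exact (hr z hz).1
    · refine lt_of_le_of_ne hx.2 fun e => hne (IsLocalMax.deriv_eq_zero ?_)
      filter_upwards [hnhds] with z hz
      rw [e]; exact (hr z hz).2

theorem exists_hit_bound (F : GeometricLorenzFlow M) : ∃ K, ∀ s : ℝ, s = 1 ∨ s = -1 →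
    ∀ p ∈ F.exitRegion, F.R (F.pt (s * F.ρ) p.1 p.2) ≤ K := by
  have h : ∀ s : ℝ, s = 1 ∨ s = -1 → ∃ K, ∀ p ∈ F.exitRegion,
      F.R (F.pt (s * F.ρ) p.1 p.2) ≤ K := fun s hs => by
    obtain ⟨K, hK⟩ := F.isCompact_exitRegion.bddAbove_image (F.continuousOn_hit s hs)
    exact ⟨K, fun p hp => hK (mem_image_of_mem _ hp)⟩
  obtain ⟨K, hK⟩ := h 1 (Or.inl rfl)
  obtain ⟨K', hK'⟩ := h (-1) (Or.inr rfl)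
  refine ⟨max K K', ?_⟩
  rintro s (rfl | rfl) p hp
  exacts [(hK p hp).trans (le_max_left _ _), (hK' p hp).trans (le_max_right _ _)]

theorem exists_deriv_a_bound (F : GeometricLorenzFlow M) : ∃ m > 0, ∀ s : ℝ, s = 1 ∨ s = -1 →
    ∀ z ∈ Icc 0 (F.exitZ 1), m ≤ |deriv (F.a s) z| := by
  have h : ∀ s : ℝ, s = 1 ∨ s = -1 → ∃ m > 0, ∀ z ∈ Icc 0 (F.exitZ 1),
      m ≤ |deriv (F.a s) z| := fun s hs => by
    have hne : (Icc 0 (F.exitZ 1)).Nonempty := ⟨F.exitZ 1, by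
      have := F.exitZ_mem (x := 1) (by simp) (by simp)
      exact ⟨this.1.le, le_rfl⟩⟩
    obtain ⟨z, hz, hmin⟩ := isCompact_Icc.exists_isMinOn hne
      (f := fun z => |deriv (F.a s) z|) fun z hz =>
      ((F.a_smooth s hs z hz).1.continuousAt_deriv_of_infty.abs).continuousWithinAt
    exact ⟨_, abs_pos.2 (F.a_smooth s hs z hz).2, fun t ht => hmin ht⟩
  obtain ⟨m, h0, hm⟩ := h 1 (Or.inl rfl)
  obtain ⟨m', h0', hm'⟩ := h (-1) (Or.inr rfl)
  refine ⟨min m m', lt_min h0 h0', ?_⟩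
  rintro s (rfl | rfl) p hp
  exacts [(min_le_left _ _).trans (hm p hp), (min_le_right _ _).trans (hm' p hp)]

/-- The logarithmic singularities of the return time and of `log |g'|` are proportional. -/
theorem exists_R_le_log_deriv (F : GeometricLorenzFlow M) : ∃ A B : ℝ, 0 ≤ A ∧ 0 ≤ B ∧
    ∀ x y : ℝ, 0 < |x| → |x| < 1 → |y| ≤ 1 →
      F.R (F.sec x y) ≤ A + B * Real.log |deriv F.g x| := by
  obtain ⟨K, hK⟩ := F.exists_hit_bound
  obtain ⟨m, hm0, hm⟩ := F.exists_deriv_a_bound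
  have hκ := F.exponent_lt_one
  have hu := F.αu_pos
  set κ := -F.αs / F.αu with hκdef
  -- `A₀` and the slope come from solving the lower bound for `log |g'|` for `log (ρ / |x|)`; this
  -- requires `κ < 1`.
  set A₀ := K - (Real.log m + Real.log (κ / F.ρ)) / (1 - κ) / F.αu with hA₀
  have hB : 0 ≤ 1 / (1 - κ) / F.αu := div_nonneg (div_nonneg zero_le_one (by linarith)) hu.le
  refine ⟨|A₀|, 1 / (1 - κ) / F.αu, abs_nonneg _, hB, fun x y h0 h1 hy => ?_⟩
  obtain ⟨d, hd, hlog⟩ := F.hasDerivAt_exitZ (abs_pos.1 h0)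
  have hs := sign_eq_one_or h0
  obtain ⟨hz0, hz1, -⟩ := F.exitZ_mem h0 h1.le
  have ha := F.a_smooth _ hs _ ⟨hz0.le, hz1⟩
  have hda : HasDerivAt (F.a (Real.sign x)) (deriv (F.a (Real.sign x)) (F.exitZ x)) (F.exitZ x) :=
    (ha.1.differentiableAt (by simp)).hasDerivAt
  have hg : HasDerivAt F.g (deriv (F.a (Real.sign x)) (F.exitZ x) * d) x := by
    refine (hda.comp x hd).congr_of_eventuallyEq ?_
    filter_upwards [eventually_sign_eq h0] with t ht
    simp only [g, LorenzSaddle.leafMap, ht, Function.comp]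
  have hgd := F.expanding x h0 h1
  change F.θ⁻¹ ≤ |deriv F.g x| at hgd
  have hθ := inv_pos.2 F.θ_pos
  have hd0 : |d| ≠ 0 := by
    intro h
    rw [hg.deriv, abs_mul, h, mul_zero] at hgd
    linarith
  have hm' := Real.log_le_log hm0 (hm _ hs _ ⟨hz0.le, hz1⟩)
  have hlog' : Real.log m + Real.log (κ / F.ρ) + (1 - κ) * Real.log (F.ρ / |x|) ≤
      Real.log |deriv F.g x| := by
    rw [hg.deriv, abs_mul, Real.log_mul (abs_pos.2 ha.2).ne' hd0, hlog]
    linarith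
  rw [(F.P_sec h0 h1.le hy).1]
  have hR := hK _ hs _ (F.exit_mem h0 h1.le hy)
  have hL : Real.log (F.ρ / |x|) ≤
      (Real.log |deriv F.g x| - (Real.log m + Real.log (κ / F.ρ))) / (1 - κ) := by
    rw [le_div_iff₀ (by linarith)]; linarith
  have hL' := div_le_div_of_nonneg_right hL hu.le
  have hA := le_abs_self A₀
  have e : (Real.log |deriv F.g x| - (Real.log m + Real.log (κ / F.ρ))) / (1 - κ) / F.αu + K =
    A₀ + 1 / (1 - κ) / F.αu * Real.log |deriv F.g x| := by rw [hA₀]; ring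
  linarith

end GeometricLorenzFlow

/-- By the mean value theorem the derivative is below `4 / p` somewhere on the piece, since the
image has length less than `2`; the distortion bound with `n = 1` carries this to every point of the
piece. -/
theorem MarkovInduction.log_abs_deriv_ghat_le {g : ℝ → ℝ} {lam : ℝ} (G : MarkovInduction g)
    (hg : IsExpandingOffZero g lam) {x : ℝ} {l : ℕ} (hx : x ∈ G.piece l) :
    Real.log |deriv G.ghat x| ≤ G.C * G.c + Real.log 4 + |Real.log (G.v l - G.u l)| := by
  have hp := G.length_pos l
  have hδ := G.δ_lt_one
  set p := G.v l - G.u l with hpdef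
  obtain ⟨ξ, hξ, hξ'⟩ : ∃ ξ ∈ G.piece l, |deriv G.ghat ξ| < 4 / p := by
    by_contra! hcon
    -- These points are `p / 2` apart; a derivative of size at least `4 / p` throughout would put
    -- their images at distance at least `2`.
    have hx1 : G.u l + p / 4 ∈ G.piece l := ⟨by linarith, by linarith⟩
    have hx2 : G.v l - p / 4 ∈ G.piece l := ⟨by linarith, by linarith⟩
    have h := mul_abs_sub_le_of_le_abs_deriv ordConnected_Ioo
      (fun _ h => (G.hasDerivAt_branch hg h).differentiableAt) hcon hx1 hx2
    have e : |G.u l + p / 4 - (G.v l - p / 4)| = p / 2 := by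
      rw [show G.u l + p / 4 - (G.v l - p / 4) = -(p / 2) by rw [hpdef]; ring, abs_neg,
        abs_of_pos (by linarith)]
    have e' : 4 / p * (p / 2) = 2 := by field_simp; norm_num
    have h1 := (G.bijOn_ghat l).mapsTo hx1
    have h2 := (G.bijOn_ghat l).mapsTo hx2
    rw [e, e'] at h
    exact h.not_gt (abs_lt.2 ⟨by linarith [h1.1, h2.2], by linarith [h1.2, h2.1]⟩)
  have h1 := hg.one_lt
  have hdx := G.le_abs_deriv_ghat hg hx
  have hd := G.abs_deriv_ghat_le hg le_rfl (x := x) (y := ξ) fun i hi => ⟨l, by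
    obtain rfl : i = 0 := by omega
    exact ⟨hx, hξ⟩⟩
  rw [pow_one] at hd
  have hd' : |deriv G.ghat x| ≤ Real.exp (G.C * G.c) * (4 / p) :=
    hd.trans (mul_le_mul_of_nonneg_left hξ'.le (Real.exp_pos _).le)
  have := Real.log_le_log (by linarith) hd'
  rw [Real.log_mul (Real.exp_pos _).ne' (by positivity), Real.log_exp,
    Real.log_div (by norm_num) hp.ne'] at this
  linarith [neg_abs_le (Real.log p)]

/-! ### The Poincaré map in coordinates, and uniqueness of the coding. -/

theorem measurable_of_countable_index {α β γ : Type*} [MeasurableSpace α] [MeasurableSpace β]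
    [MeasurableSpace γ] [Countable γ] [MeasurableSingletonClass γ] {k : α → γ} (hk : Measurable k)
    {f : γ → α → β} (hf : ∀ n, Measurable (f n)) : Measurable fun a => f (k a) a :=
  (measurable_from_prod_countable_right (f := fun p : γ × α => f p.1 p.2) hf).comp
    (hk.prodMk measurable_id)

namespace GeometricLorenzFlow

variable {M : Type*} [TopologicalSpace M]
    [ChartedSpace (EuclideanSpace ℝ (Fin 3)) M] [IsManifold (𝓡 3) ∞ M]

/-- The coordinates of `S \ Γ`. -/
def secDomain : Set (ℝ × ℝ) := {p | 0 < |p.1| ∧ |p.1| ≤ 1 ∧ |p.2| ≤ 1}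

theorem measurableSet_secDomain : MeasurableSet secDomain := by
  have h1 : Measurable fun p : ℝ × ℝ => |p.1| := continuous_fst.abs.measurable
  have h2 : Measurable fun p : ℝ × ℝ => |p.2| := continuous_snd.abs.measurable
  exact (measurableSet_lt measurable_const h1).inter
    ((measurableSet_le h1 measurable_const).inter (measurableSet_le h2 measurable_const))

open Classical in
/-- The Poincaré transformation in coordinates, extended by `0`. -/
def coordP (F : GeometricLorenzFlow M) : ℝ × ℝ → ℝ × ℝ :=
  secDomain.piecewise (fun p => (F.g p.1, F.h p.1 p.2)) fun _ => 0

open Classical in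
/-- The return time to `S` in coordinates, extended by `0`. -/
def coordR (F : GeometricLorenzFlow M) : ℝ × ℝ → ℝ :=
  secDomain.piecewise (fun p => F.R (F.sec p.1 p.2)) fun _ => 0

theorem coordP_eq (F : GeometricLorenzFlow M) {p : ℝ × ℝ} (hp : p ∈ secDomain) :
    F.coordP p = (F.g p.1, F.h p.1 p.2) := by
  classical
  exact piecewise_eq_of_mem _ _ _ hp

theorem coordR_eq (F : GeometricLorenzFlow M) {p : ℝ × ℝ} (hp : p ∈ secDomain) :
    F.coordR p = F.R (F.sec p.1 p.2) := by
  classical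
  exact piecewise_eq_of_mem _ _ _ hp

theorem continuous_exit (F : GeometricLorenzFlow M) :
    Continuous fun p : ℝ × ℝ => (F.exitY p.1 p.2, F.exitZ p.1) :=
  F.continuous_exitY.prodMk (F.continuous_exitZ.comp continuous_fst)

theorem eventually_sign_fst_eq {p : ℝ × ℝ} (hp : p ∈ secDomain) :
    ∀ᶠ q in 𝓝[secDomain] p, Real.sign q.1 = Real.sign p.1 :=
  nhdsWithin_le_nhds (continuous_fst.continuousAt.eventually (eventually_sign_eq hp.1))

theorem measurable_coordP (F : GeometricLorenzFlow M) : Measurable F.coordP := by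
  classical
  refine ContinuousOn.measurable_piecewise (fun p hp => ?_) continuousOn_const
    measurableSet_secDomain
  have hs := sign_eq_one_or hp.1
  obtain ⟨hz0, hz1, -⟩ := F.exitZ_mem hp.1 hp.2.1
  have hev := eventually_sign_fst_eq hp
  refine ContinuousWithinAt.prodMk ?_ ?_
  · have h1 : ContinuousAt (fun q : ℝ × ℝ => F.a (Real.sign p.1) (F.exitZ q.1)) p :=
      ContinuousAt.comp (f := fun q : ℝ × ℝ => F.exitZ q.1)
        (F.a_smooth _ hs _ ⟨hz0.le, hz1⟩).1.continuousAt
        (F.continuous_exitZ.comp continuous_fst).continuousAt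
    refine h1.continuousWithinAt.congr_of_eventuallyEq ?_ rfl
    filter_upwards [hev] with q hq
    simp only [g, LorenzSaddle.leafMap, hq]
  · have h1 : ContinuousAt
        (fun q : ℝ × ℝ => F.b (Real.sign p.1) (F.exitY q.1 q.2, F.exitZ q.1)) p :=
      ContinuousAt.comp (f := fun q : ℝ × ℝ => (F.exitY q.1 q.2, F.exitZ q.1))
        (F.b_smooth _ hs _ (F.exit_mem hp.1 hp.2.1 hp.2.2)).continuousAt
        F.continuous_exit.continuousAt
    refine h1.continuousWithinAt.congr_of_eventuallyEq ?_ rfl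
    filter_upwards [hev] with q hq
    simp only [h, LorenzSaddle.fiberMap, hq]

/-- The sign of `x` is locally constant on the domain. The hitting time is only known to be
continuous within the exit region, so the continuity is relative to `secDomain`. -/
theorem measurable_coordR (F : GeometricLorenzFlow M) : Measurable F.coordR := by
  classical
  refine ContinuousOn.measurable_piecewise (fun p hp => ?_) continuousOn_const
    measurableSet_secDomain
  have hs := sign_eq_one_or hp.1
  have hρ := F.ρ_pos
  have h1 : ContinuousAt (fun q : ℝ × ℝ => Real.log (F.ρ / |q.1|) / F.αu) p :=
    ((continuousAt_const.div continuous_fst.abs.continuousAt hp.1.ne').log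
      (div_pos hρ hp.1).ne').div_const _
  have h2 : ContinuousWithinAt (fun q : ℝ × ℝ =>
      F.R (F.pt (Real.sign p.1 * F.ρ) (F.exitY q.1 q.2) (F.exitZ q.1))) secDomain p :=
    ContinuousWithinAt.comp (f := fun q : ℝ × ℝ => (F.exitY q.1 q.2, F.exitZ q.1))
      (F.continuousOn_hit _ hs _ (F.exit_mem hp.1 hp.2.1 hp.2.2))
      F.continuous_exit.continuousWithinAt fun q hq => F.exit_mem hq.1 hq.2.1 hq.2.2
  refine (h1.continuousWithinAt.add h2).congr_of_eventuallyEq ?_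
    (F.P_sec hp.1 hp.2.1 hp.2.2).1
  filter_upwards [eventually_sign_fst_eq hp, self_mem_nhdsWithin] with q hq hqS
  rw [(F.P_sec hqS.1 hqS.2.1 hqS.2.2).1, hq, Pi.add_apply]

theorem abs_h_sub_le (F : GeometricLorenzFlow M) {x y y' : ℝ} (h0 : 0 < |x|) (h1 : |x| ≤ 1)
    (hy : |y| ≤ 1) (hy' : |y'| ≤ 1) : |F.h x y - F.h x y'| ≤ F.θ * |y - y'| := by
  have hs := sign_eq_one_or h0
  refine (convex_Icc (-1 : ℝ) 1).norm_image_sub_le_of_norm_deriv_le (f := F.h x) (fun t ht => ?_)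
    (fun t ht => F.contracting x t h0 h1 (abs_le.2 ht)) (abs_le.1 hy') (abs_le.1 hy)
  have hd : DifferentiableAt ℝ (fun t => (F.exitY x t, F.exitZ x)) t :=
    (differentiableAt_id.mul_const _).prodMk (differentiableAt_const _)
  exact DifferentiableAt.comp (g := F.b (Real.sign x)) t ((F.b_smooth _ hs _
    (F.exit_mem h0 h1 (abs_le.2 ht))).differentiableAt (by simp)) hd

variable (F : GeometricLorenzFlow M) (G : MarkovInduction F.g)

theorem iterate_coordP {x y : ℝ} {l j : ℕ} (hx : x ∈ G.piece l) (hy : |y| ≤ 1) (hj : j ≤ G.r l) :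
    (F.coordP^[j] (x, y)).1 = F.g^[j] x ∧ |(F.coordP^[j] (x, y)).2| ≤ 1 ∧
      F.P^[j] (F.sec x y) = F.sec (F.coordP^[j] (x, y)).1 (F.coordP^[j] (x, y)).2 := by
  induction j with
  | zero => exact ⟨rfl, hy, rfl⟩
  | succ j ih =>
    obtain ⟨e1, e2, e3⟩ := ih (Nat.le_of_succ_le hj)
    have hne := G.avoid l x hx j hj
    have hlt := G.abs_iterate_lt_one F.isExpandingOffZero hx (Nat.le_of_succ_le hj)
    simp only [Function.iterate_succ_apply']
    set p := F.coordP^[j] (x, y)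
    have hp : p ∈ secDomain := ⟨by rw [e1]; exact abs_pos.2 hne, by rw [e1]; exact hlt.le, e2⟩
    have hP := F.P_sec hp.1 hp.2.1 hp.2.2
    rw [F.coordP_eq hp, e3, hP.2.1, e1]
    rw [e1] at hP
    exact ⟨rfl, abs_le.2 hP.2.2.2, rfl⟩

theorem iterate_coordP_mem {x y : ℝ} {l j : ℕ} (hx : x ∈ G.piece l) (hy : |y| ≤ 1)
    (hj : j < G.r l) : F.coordP^[j] (x, y) ∈ secDomain := by
  obtain ⟨e1, e2, -⟩ := F.iterate_coordP G hx hy hj.le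
  refine ⟨?_, ?_, e2⟩ <;> rw [e1]
  · exact abs_pos.2 (G.avoid l x hx j hj)
  · exact (G.abs_iterate_lt_one F.isExpandingOffZero hx hj.le).le

theorem abs_iterate_coordP_snd_sub_le {x y y' : ℝ} {l j : ℕ} (hx : x ∈ G.piece l) (hy : |y| ≤ 1)
    (hy' : |y'| ≤ 1) (hj : j ≤ G.r l) :
    |(F.coordP^[j] (x, y)).2 - (F.coordP^[j] (x, y')).2| ≤ F.θ ^ j * |y - y'| := by
  induction j with
  | zero => simp
  | succ j ih =>
    have ih' := ih (Nat.le_of_succ_le hj)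
    have hp := F.iterate_coordP_mem G hx hy hj
    have hp' := F.iterate_coordP_mem G hx hy' hj
    have e := (F.iterate_coordP G hx hy (Nat.le_of_succ_le hj)).1
    have e' := (F.iterate_coordP G hx hy' (Nat.le_of_succ_le hj)).1
    simp only [Function.iterate_succ_apply']
    rw [F.coordP_eq hp, F.coordP_eq hp', e', ← e]
    refine (F.abs_h_sub_le hp.1 hp.2.1 hp.2.2 hp'.2.2).trans ?_
    rw [pow_succ', mul_assoc]
    exact mul_le_mul_of_nonneg_left ih' F.θ_pos.le

/-- `z` is a two-sided orbit of the return map, in coordinates, with itinerary `w`. -/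
def IsCoordCoded (w : ℤ → ℕ) (z : ℤ → ℝ × ℝ) : Prop :=
  ∀ n : ℤ, ((z n).1 ∈ G.piece (w n) ∧ (z n).2 ∈ Icc (-1 : ℝ) 1) ∧
    F.coordP^[G.r (w n)] (z n) = z (n + 1)

variable {F G}

theorem IsCoordCoded.isCoded {w : ℤ → ℕ} {z : ℤ → ℝ × ℝ} (hz : F.IsCoordCoded G w z) :
    F.IsCoded G w fun n => F.sec (z n).1 (z n).2 := fun n => by
  refine ⟨⟨_, (hz n).1.1, _, (hz n).1.2, rfl⟩, ?_⟩
  rw [(F.iterate_coordP G (hz n).1.1 (abs_le.2 (hz n).1.2) le_rfl).2.2, (hz n).2]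

theorem abs_le_one_of_mem_piece {x : ℝ} {l : ℕ} (hx : x ∈ G.piece l) : |x| ≤ 1 :=
  (G.abs_iterate_lt_one F.isExpandingOffZero hx (Nat.zero_le _)).le

theorem IsCoded.exists_isCoordCoded {w : ℤ → ℕ} {q : ℤ → M} (hq : F.IsCoded G w q) :
    ∃ z, F.IsCoordCoded G w z ∧ ∀ n, q n = F.sec (z n).1 (z n).2 := by
  choose x hx y hy e using fun n => (hq n).1
  refine ⟨fun n => (x n, y n), fun n => ⟨⟨hx n, hy n⟩, ?_⟩, e⟩
  have h := (hq n).2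
  obtain ⟨e1, e2, e3⟩ := F.iterate_coordP G (hx n) (abs_le.2 (hy n)) le_rfl
  rw [e n, e (n + 1), e3] at h
  have h1 := (G.bijOn_ghat (w n)).mapsTo (hx n)
  rw [G.ghat_eq (hx n), ← e1] at h1
  have h2 := G.δ_lt_one
  have := F.sec_injOn (abs_le.2 ⟨by linarith [h1.1], by linarith [h1.2]⟩) e2
    (abs_le_one_of_mem_piece (hx (n + 1))) (abs_le.2 (hy (n + 1))) h
  exact Prod.ext this.1 this.2

theorem IsCoordCoded.ghat_fst {w : ℤ → ℕ} {z : ℤ → ℝ × ℝ} (hz : F.IsCoordCoded G w z) (n : ℤ) :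
    G.ghat (z n).1 = (z (n + 1)).1 := by
  rw [← (hz n).2, G.ghat_eq (hz n).1.1]
  exact (F.iterate_coordP G (hz n).1.1 (abs_le.2 (hz n).1.2) le_rfl).1.symm

theorem IsCoordCoded.iterate_ghat_fst {w : ℤ → ℕ} {z : ℤ → ℝ × ℝ} (hz : F.IsCoordCoded G w z)
    (n : ℤ) (k : ℕ) : G.ghat^[k] (z n).1 = (z (n + k)).1 := by
  induction k with
  | zero => simp
  | succ k ih =>
    rw [Function.iterate_succ_apply', ih, hz.ghat_fst]
    push_cast
    rw [add_assoc]

/-- The forward itinerary fixes the leaf: distinct first coordinates would be separated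
exponentially, yet they stay in `[-1, 1]`. -/
theorem IsCoordCoded.fst_eq {w : ℤ → ℕ} {z z' : ℤ → ℝ × ℝ} (hz : F.IsCoordCoded G w z)
    (hz' : F.IsCoordCoded G w z') (n : ℤ) : (z n).1 = (z' n).1 := by
  have h1 := F.isExpandingOffZero.one_lt
  by_contra hne
  have hpos := abs_pos.2 (sub_ne_zero.2 hne)
  obtain ⟨k, hk⟩ := pow_unbounded_of_one_lt (2 / |(z n).1 - (z' n).1|) h1
  rw [div_lt_iff₀ hpos] at hk
  have h := G.pow_mul_abs_sub_le F.isExpandingOffZero (n := k) (v := fun i => w (n + i))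
    (x := (z n).1) (y := (z' n).1)
    (fun i _ => by rw [hz.iterate_ghat_fst]; exact (hz _).1.1)
    (fun i _ => by rw [hz'.iterate_ghat_fst]; exact (hz' _).1.1)
  rw [hz.iterate_ghat_fst, hz'.iterate_ghat_fst] at h
  have e1 := abs_le.1 (abs_le_one_of_mem_piece (hz (n + k)).1.1)
  have e2 := abs_le.1 (abs_le_one_of_mem_piece (hz' (n + k)).1.1)
  have : |(z (n + k)).1 - (z' (n + k)).1| ≤ 2 :=
    abs_le.2 ⟨by linarith [e1.1, e2.2], by linarith [e1.2, e2.1]⟩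
  linarith

theorem θ_lt_one (F : GeometricLorenzFlow M) : F.θ < 1 := by
  have := F.isExpandingOffZero.one_lt
  exact (one_lt_inv₀ F.θ_pos).1 this

/-- Both orbits run through the same leaves, so going `k` returns into the past exhibits `k`
contractions by `θ`. -/
theorem IsCoordCoded.abs_snd_sub_le {w : ℤ → ℕ} {z z' : ℤ → ℝ × ℝ} (hz : F.IsCoordCoded G w z)
    (hz' : F.IsCoordCoded G w z') (n : ℤ) (k : ℕ) :
    |(z n).2 - (z' n).2| ≤ F.θ ^ k * |(z (n - k)).2 - (z' (n - k)).2| := by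
  have hstep : ∀ m, |(z (m + 1)).2 - (z' (m + 1)).2| ≤ F.θ * |(z m).2 - (z' m).2| := by
    intro m
    have e : z' m = ((z m).1, (z' m).2) := Prod.ext (hz.fst_eq hz' m).symm rfl
    have h := F.abs_iterate_coordP_snd_sub_le G (hz m).1.1 (abs_le.2 (hz m).1.2)
      (abs_le.2 (hz' m).1.2) le_rfl
    rw [← e, (hz m).2, (hz' m).2] at h
    refine h.trans (mul_le_mul_of_nonneg_right ?_ (abs_nonneg _))
    exact pow_le_of_le_one F.θ_pos.le F.θ_lt_one.le (G.r_pos _).ne'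
  induction k with
  | zero => simp
  | succ k ih =>
    refine ih.trans ?_
    rw [pow_succ, mul_assoc]
    have := hstep (n - (k + 1 : ℕ))
    rw [show n - ((k + 1 : ℕ) : ℤ) + 1 = n - k by push_cast; ring] at this
    exact mul_le_mul_of_nonneg_left this (pow_nonneg F.θ_pos.le k)

theorem IsCoordCoded.unique {w : ℤ → ℕ} {z z' : ℤ → ℝ × ℝ} (hz : F.IsCoordCoded G w z)
    (hz' : F.IsCoordCoded G w z') : z = z' := by
  funext n
  refine Prod.ext (hz.fst_eq hz' n) ?_
  have ht : Tendsto (fun k : ℕ => F.θ ^ k * 2) atTop (𝓝 0) := by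
    simpa using (tendsto_pow_atTop_nhds_zero_of_lt_one F.θ_pos.le F.θ_lt_one).mul_const 2
  have h : |(z n).2 - (z' n).2| ≤ 0 := by
    refine ge_of_tendsto' ht fun k => (hz.abs_snd_sub_le hz' n k).trans ?_
    have e1 := (hz (n - k)).1.2
    have e2 := (hz' (n - k)).1.2
    exact mul_le_mul_of_nonneg_left
      (abs_le.2 ⟨by linarith [e1.1, e2.2], by linarith [e1.2, e2.1]⟩) (pow_nonneg F.θ_pos.le k)
  linarith [abs_eq_zero.1 (le_antisymm h (abs_nonneg _))]

/-! ### Measurability of the return time. -/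

variable (F G)

/-- The graph of the coding map. -/
def codingGraph : Set ((ℤ → ℕ) × (ℤ → ℝ × ℝ)) := {p | F.IsCoordCoded G p.1 p.2}

theorem measurableSet_codingGraph : MeasurableSet (F.codingGraph G) := by
  have e : F.codingGraph G = ⋂ n : ℤ,
      (((fun p => (p.2 n).1 - G.u (p.1 n)) ⁻¹' Ioi 0 ∩ (fun p => G.v (p.1 n) - (p.2 n).1) ⁻¹' Ioi 0) ∩
        (fun p => (p.2 n).2) ⁻¹' Icc (-1) 1) ∩
      {p | F.coordP^[G.r (p.1 n)] (p.2 n) = p.2 (n + 1)} := by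
    ext p
    simp [codingGraph, IsCoordCoded, ReturnScheme.piece]
  rw [e]
  refine .iInter fun n => ?_
  have hw : Measurable fun p : (ℤ → ℕ) × (ℤ → ℝ × ℝ) => p.1 n :=
    (measurable_pi_apply n).comp measurable_fst
  have hz : ∀ n, Measurable fun p : (ℤ → ℕ) × (ℤ → ℝ × ℝ) => p.2 n := fun n =>
    (measurable_pi_apply n).comp measurable_snd
  refine .inter (.inter (.inter ?_ ?_) ?_) ?_
  · exact ((hz n).fst.sub ((measurable_of_countable G.u).comp hw)) measurableSet_Ioi
  · exact (((measurable_of_countable G.v).comp hw).sub (hz n).fst) measurableSet_Ioi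
  · exact (hz n).snd measurableSet_Icc
  · exact measurableSet_eq_fun (measurable_of_countable_index hw
      (f := fun l p => F.coordP^[G.r l] (p.2 n))
      fun l => (F.measurable_coordP.iterate _).comp (hz n)) (hz (n + 1))

theorem injOn_fst_codingGraph : InjOn Prod.fst (F.codingGraph G) := by
  rintro ⟨w, z⟩ hz ⟨w', z'⟩ hz' (rfl : w = w')
  rw [show z = z' from IsCoordCoded.unique hz hz']

variable {F G}

/-- The return time of a coded point in coordinates. -/
theorem IsCoordCoded.T_eq {w : ℤ → ℕ} {z : ℤ → ℝ × ℝ} (hz : F.IsCoordCoded G w z) :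
    F.T G w = ∑ j ∈ Finset.range (G.r (w 0)), F.coordR (F.coordP^[j] (z 0)) := by
  have hex : ∃ q, F.IsCoded G w q := ⟨_, hz.isCoded⟩
  obtain ⟨z', hz', e⟩ := hex.choose_spec.exists_isCoordCoded
  obtain rfl := hz.unique hz'
  have hc : F.coding G w = F.sec (z 0).1 (z 0).2 := by rw [coding, dif_pos hex, e 0]
  refine Finset.sum_congr rfl fun j hj => ?_
  rw [Finset.mem_range] at hj
  have hx := (hz 0).1.1
  have hy := abs_le.2 (hz 0).1.2
  rw [hc, (F.iterate_coordP G hx hy hj.le).2.2]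
  exact (F.coordR_eq (F.iterate_coordP_mem G hx hy hj)).symm

/-- The default value of the coding is the singularity, a fixed point of `P`. So `T` stays explicit
on uncoded sequences, and the later bound covers them without an estimate of their measure. -/
theorem T_eq_of_not_coded {w : ℤ → ℕ} (hw : w ∉ Prod.fst '' F.codingGraph G) :
    F.T G w = G.r (w 0) * F.R (F.pt 0 0 0) := by
  have hex : ¬∃ q, F.IsCoded G w q := by
    rintro ⟨q, hq⟩
    obtain ⟨z, hz, -⟩ := hq.exists_isCoordCoded
    exact hw ⟨(w, z), hz, rfl⟩
  have hc : F.coding G w = F.pt 0 0 0 := by rw [coding, dif_neg hex]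
  have hP : ∀ j, F.P^[j] (F.pt 0 0 0) = F.pt 0 0 0 := fun j =>
    Function.iterate_fixed F.P_singularity j
  simp [T, hc, hP]

variable (F G)

/-- Lusin–Souslin: the projection of the Borel graph to the sequences is injective, hence maps Borel
subsets of the graph to Borel sets. The preimage under `T` splits into such an image and a part on
the uncoded sequences. -/
theorem measurable_T : Measurable (F.T G) := by
  intro B hB
  set τ : (ℤ → ℕ) × (ℤ → ℝ × ℝ) → ℝ :=
    fun p => ∑ j ∈ Finset.range (G.r (p.1 0)), F.coordR (F.coordP^[j] (p.2 0)) with hτ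
  have hτm : Measurable τ := by
    refine measurable_of_countable_index
      (k := fun p : (ℤ → ℕ) × (ℤ → ℝ × ℝ) => p.1 0)
      ((measurable_pi_apply 0).comp measurable_fst)
      (f := fun l p => ∑ j ∈ Finset.range (G.r l), F.coordR (F.coordP^[j] (p.2 0))) fun l => ?_
    refine Finset.measurable_sum _ fun j _ => F.measurable_coordR.comp
      ((F.measurable_coordP.iterate j).comp ((measurable_pi_apply 0).comp measurable_snd))
  have hE := F.measurableSet_codingGraph G
  have hinj := F.injOn_fst_codingGraph G
  have hσ : Measurable fun w : ℤ → ℕ => (G.r (w 0) : ℝ) * F.R (F.pt 0 0 0) :=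
    (measurable_of_countable fun l : ℕ => (G.r l : ℝ) * F.R (F.pt 0 0 0)).comp
      (measurable_pi_apply 0)
  have e : F.T G ⁻¹' B = Prod.fst '' (F.codingGraph G ∩ τ ⁻¹' B) ∪
      ((Prod.fst '' F.codingGraph G)ᶜ ∩
        (fun w : ℤ → ℕ => (G.r (w 0) : ℝ) * F.R (F.pt 0 0 0)) ⁻¹' B) := by
    ext w
    by_cases hw : w ∈ Prod.fst '' F.codingGraph G
    · obtain ⟨⟨w, z⟩, hz, rfl⟩ := hw
      have hT : F.T G w = τ (w, z) := IsCoordCoded.T_eq hz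
      constructor
      · intro h
        exact Or.inl ⟨(w, z), ⟨hz, by rwa [mem_preimage, ← hT]⟩, rfl⟩
      · rintro (⟨⟨w', z'⟩, ⟨hz', hB'⟩, (rfl : w' = w)⟩ | ⟨h, -⟩)
        · have hT' : F.T G w' = τ (w', z') := IsCoordCoded.T_eq hz'
          rwa [mem_preimage, hT']
        · exact absurd ⟨(w, z), hz, rfl⟩ h
    · rw [mem_preimage, T_eq_of_not_coded hw]
      constructor
      · exact fun h => Or.inr ⟨hw, h⟩
      · rintro (⟨p, hp, rfl⟩ | h)
        · exact absurd ⟨p, hp.1, rfl⟩ hw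
        · exact h.2
  rw [e]
  exact ((hE.inter (hτm hB)).image_of_measurable_injOn measurable_fst
    (hinj.mono inter_subset_left)).union
    ((hE.image_of_measurable_injOn measurable_fst hinj).compl.inter (hσ hB))

/-! ### Domination by the zeroth symbol, and its distribution. -/

theorem T_nonneg (w : ℤ → ℕ) : 0 ≤ F.T G w := Finset.sum_nonneg fun _ _ => F.R_nonneg _

/-- The return time is bounded by a function of the zeroth symbol. -/
theorem exists_T_le : ∃ A B : ℝ, 0 ≤ A ∧ 0 ≤ B ∧ ∀ w,
    F.T G w ≤ A * G.r (w 0) + B * |Real.log (G.v (w 0) - G.u (w 0))| := by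
  obtain ⟨A, B, hA, hB, hR⟩ := F.exists_R_le_log_deriv
  have hg := F.isExpandingOffZero
  have hR0 := F.R_nonneg (F.pt 0 0 0)
  have hCc : 0 ≤ G.C * G.c + Real.log 4 :=
    add_nonneg (mul_nonneg (G.C_nonneg hg) G.c_pos.le) (Real.log_nonneg (by norm_num))
  -- Additive constants are absorbed into the coefficient of `r` since `r ≥ 1`; the last summand
  -- serves the uncoded sequences.
  refine ⟨A + B * (G.C * G.c + Real.log 4) + F.R (F.pt 0 0 0), B, by positivity, hB, fun w => ?_⟩
  have hr : (1 : ℝ) ≤ G.r (w 0) := by exact_mod_cast G.r_pos (w 0)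
  have hBC := mul_nonneg hB hCc
  have hlog := mul_nonneg hB (abs_nonneg (Real.log (G.v (w 0) - G.u (w 0))))
  by_cases hw : w ∈ Prod.fst '' F.codingGraph G
  · obtain ⟨⟨w, z⟩, hz, rfl⟩ := hw
    have hx := (hz 0).1.1
    have hy := abs_le.2 (hz 0).1.2
    dsimp only at hx hy hr hlog ⊢
    -- By the chain rule, the sum of the `log |g'|` along the excursion is `log |ghat'|`.
    have h1 : F.T G w ≤ A * G.r (w 0) + B * Real.log |deriv G.ghat (z 0).1| := by
      rw [IsCoordCoded.T_eq hz, (G.hasDerivAt_branch hg hx).deriv, Finset.abs_prod, Real.log_prod]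
      · rw [Finset.mul_sum]
        calc _ ≤ ∑ j ∈ Finset.range (G.r (w 0)),
              (A + B * Real.log |deriv F.g (F.g^[j] (z 0).1)|) := by
              refine Finset.sum_le_sum fun j hj => ?_
              rw [Finset.mem_range] at hj
              obtain ⟨e1, e2, -⟩ := F.iterate_coordP G hx hy hj.le
              rw [F.coordR_eq (F.iterate_coordP_mem G hx hy hj), ← e1]
              refine hR _ _ ?_ ?_ e2
              · rw [e1]; exact abs_pos.2 (G.avoid _ _ hx j hj)
              · rw [e1]; exact G.abs_iterate_lt_one hg hx hj.le
          _ = _ := by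
              rw [Finset.sum_add_distrib, Finset.sum_const, Finset.card_range, nsmul_eq_mul,
                mul_comm A]
      · intro j hj
        rw [Finset.mem_range] at hj
        have := hg.le_abs_deriv _ (abs_pos.2 (G.avoid _ _ hx j hj))
          (G.abs_iterate_lt_one hg hx hj.le)
        linarith [hg.one_lt]
    have h2 := mul_le_mul_of_nonneg_left (G.log_abs_deriv_ghat_le hg hx) hB
    nlinarith
  · rw [T_eq_of_not_coded hw]
    nlinarith

end GeometricLorenzFlow

theorem ReturnScheme.measurable_index {g : ℝ → ℝ} (G : ReturnScheme g) : Measurable G.index := by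
  have hU : MeasurableSet (⋃ l, G.piece l) := .iUnion G.measurableSet_piece
  refine measurable_to_countable' fun l => ?_
  have e : G.index ⁻¹' {l} = G.piece l ∪ ((⋃ l, G.piece l)ᶜ ∩ {_x | l = 0}) := by
    ext x
    by_cases hx : ∃ k, x ∈ G.piece k
    · have hxU : x ∈ ⋃ l, G.piece l := mem_iUnion.2 hx
      obtain ⟨k, hk⟩ := hx
      simp only [mem_preimage, G.index_eq hk, mem_singleton_iff, mem_union, mem_inter_iff,
        mem_compl_iff, hxU, not_true, false_and, or_false]
      exact ⟨fun h => h ▸ hk, fun h => (G.index_eq hk).symm.trans (G.index_eq h)⟩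
    · have hxU : x ∉ ⋃ l, G.piece l := fun h => hx (mem_iUnion.1 h)
      have hxl : x ∉ G.piece l := fun h => hx ⟨l, h⟩
      have h0 : G.index x = 0 := by rw [ReturnScheme.index, dif_neg hx]
      simp only [mem_preimage, h0, mem_singleton_iff, mem_union, mem_inter_iff, mem_compl_iff, hxU,
        hxl, not_false_iff, true_and, false_or, mem_ofPred_eq]
      exact eq_comm
  rw [e]
  exact (G.measurableSet_piece l).union (hU.compl.inter (.const _))

theorem IsLift.measure_symbol_le {g : ℝ → ℝ} {lam : ℝ} {G : MarkovInduction g} {μhat : Measure ℝ}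
    {μ : Measure (ℤ → ℕ)} (hμ : IsLift G μhat μ) (hμhat : IsACErgodic G μhat)
    (hg : IsExpandingOffZero g lam) (l : ℕ) :
    μ.map (fun w => w 0) {l} ≤ G.mixingConst * ENNReal.ofReal (G.v l - G.u l) := by
  have hi : Measurable G.itinerary := measurable_pi_lambda _ fun n =>
    G.measurable_index.comp (hμhat.ergodic.measurable.iterate n)
  have hone : Measurable toOneSided := measurable_pi_lambda _ fun n => measurable_pi_apply _
  have hset : MeasurableSet {s : ℕ → ℕ | s 0 = l} :=
    measurableSet_eq_fun (measurable_pi_apply 0) measurable_const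
  calc μ.map (fun w => w 0) {l} = μ.map toOneSided {s | s 0 = l} := by
        rw [Measure.map_apply (measurable_pi_apply 0) (measurableSet_singleton l),
          Measure.map_apply hone hset]
        rfl
    _ = μhat (G.itinerary ⁻¹' {s | s 0 = l}) := by rw [hμ.proj, Measure.map_apply hi hset]
    -- Only almost everywhere: off the pieces `index` has the default value `0`.
    _ ≤ μhat (G.piece l) := by
        refine measure_mono_ae ?_
        filter_upwards [hμhat.ae_mem_iUnion_piece] with x hx (hxl : G.index x = l)
        obtain ⟨k, hk⟩ := hx.2
        rw [← hxl, G.index_eq hk]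
        exact hk
    _ ≤ G.mixingConst * volume (G.piece l) :=
        hμhat.measure_le hg (G.measurableSet_piece l) (by simp [ReturnScheme.piece])
    _ = _ := by rw [ReturnScheme.piece, Real.volume_Ioo]

end

theorem proposition3p2 {M : Type*} [TopologicalSpace M] [T2Space M] [SecondCountableTopology M]
    [ChartedSpace (EuclideanSpace ℝ (Fin 3)) M] [IsManifold (𝓡 3) ∞ M]
    (F : GeometricLorenzFlow M) (G : MarkovInduction F.g)
    (μhat : Measure ℝ) (hμhat : IsACErgodic G μhat)
    (μ : Measure (ℤ → ℕ)) (hμ : IsLift G μhat μ) :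
    Integrable (F.T G) μ := by
  have hg := F.isExpandingOffZero
  obtain ⟨A, B, hA, hB, hT⟩ := F.exists_T_le G
  refine ⟨(F.measurable_T G).aestronglyMeasurable, ?_⟩
  set τ : ℕ → ℝ := fun l => A * G.r l + B * |Real.log (G.v l - G.u l)| with hτ
  have hτ0 : ∀ l, 0 ≤ τ l := fun l => by positivity
  have hsum : Summable fun l => τ l * (G.v l - G.u l) := by
    refine ((G.summable_r_mul_length.mul_left A).add
      ((G.summable_length_mul_log hg).mul_left B)).congr fun l => ?_
    simp only [hτ]; ring
  calc ∫⁻ w, ‖F.T G w‖ₑ ∂μ ≤ ∫⁻ w, ENNReal.ofReal (τ (w 0)) ∂μ := lintegral_mono fun w => by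
        rw [Real.enorm_eq_ofReal (F.T_nonneg G w)]
        exact ENNReal.ofReal_le_ofReal (hT w)
    _ = ∫⁻ l, ENNReal.ofReal (τ l) ∂(μ.map fun w => w 0) :=
        (lintegral_map (f := fun l => ENNReal.ofReal (τ l)) (g := fun w : ℤ → ℕ => w 0)
          (measurable_of_countable _) (measurable_pi_apply 0)).symm
    _ = ∑' l, ENNReal.ofReal (τ l) * μ.map (fun w => w 0) {l} := lintegral_countable' _
    _ ≤ ∑' l, G.mixingConst * ENNReal.ofReal (τ l * (G.v l - G.u l)) := by
        refine ENNReal.tsum_le_tsum fun l => ?_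
        rw [ENNReal.ofReal_mul (hτ0 l), mul_left_comm]
        gcongr
        exact hμ.measure_symbol_le hμhat hg l
    _ = G.mixingConst * ENNReal.ofReal (∑' l, τ l * (G.v l - G.u l)) := by
        rw [ENNReal.tsum_mul_left, ENNReal.ofReal_tsum_of_nonneg
          (fun l => mul_nonneg (hτ0 l) (G.length_pos l).le) hsum]
    _ < ⊤ := ENNReal.mul_lt_top ENNReal.ofReal_lt_top ENNReal.ofReal_lt_top
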